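/- Fix $q\ge 2$. For a finite simple graph $G$ and lists $\Lambda\colon V(G)\to 2^{[q]}$, the problem $q$-List-Coloring asks for a proper coloring $\gamma\colon V(G)\to[q]$ of $G$ with $\gamma(v)\in\Lambda(v)$ for all $v$; $q$-Coloring is the case in which all lists equal $[q]$. Let $g\colon\mathbb N\to\mathbb N$. A graph class $\mathcal F$ has \emph{$g(q)$-size No-certificates for $q$-List-Coloring} if for every $G\in\mathcal F$ and all lists $\Lambda$ such that $(G,\Lambda)$ has answer No, there is a set $S\subseteq V(G)$ with $|S|\le g(q)$ such that $(G[S],\Lambda|_S)$ has answer No. A \emph{modulator} of $G$ to $\mathcal F$ is a set $X\subseteq V(G)$ with $G-X\in\mathcal F$. The notation $\mathcal O^*(\theta^k)$ means $\mathcal O(\theta^k\cdot n^{\mathcal O(1)})$, where $n=|V(G)|$; the hidden constants may depend on $\mathcal F$ and $q$. \textbf{Theorem.} Let $q\ge 2$ and let $\mathcal F$ be a graph class with $g(q)$-size No-certificates for $q$-List-Coloring. Then there is an $\varepsilon$ with $0<\varepsilon<q$ such that $q$-List-Coloring and $q$-Coloring on graphs $G$ that are given together with a modulator $X$ to $\mathcal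 F$ of size $k$ (and, for $q$-List-Coloring, with lists $\Lambda$) can be solved by deterministic algorithms in time $\mathcal O^*((q-\varepsilon)^k)$. Moreover, if $g(q)\ge 1$, these algorithms run in time $$\mathcal O^*\!\left(\left(\sqrt[g(q)\cdot q]{q^{\,g(q)\cdot q}-1}\right)^{k}\right).$$ In both bounds the degree of the hidden polynomial is bounded by a function of $g(q)$ only. (Running time is the number of steps of a random access machine with addition, subtraction and indirect addressing.) -/

import Mathlib

/-! ### Graph classes, list colorings, and No-certificates -/

/-- A class of graphs: a collection of (labelled) graphs. Membership is only ever tested for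
graphs on finite vertex sets. Closure under isomorphism is not needed and not required. -/
def GraphClass : Type 1 := (V : Type) → Set (SimpleGraph V)

/-- The instance `(G, Λ)` of `q`-List-Coloring has answer Yes: there is a proper coloring of `G`
that gives every vertex a color from its list. The set of colors is `Fin q`. -/
def ListColorable {V : Type} {q : ℕ} (G : SimpleGraph V) (Λ : V → Finset (Fin q)) : Prop :=
  ∃ γ : G.Coloring (Fin q), ∀ v, γ v ∈ Λ v

/-- `F` has `g(q)`-size No-certificates for `q`-List-Coloring: every No-instance `(G, Λ)` with
`G ∈ F` has a No-subinstance (an induced subgraph with the same lists) on at most `g q`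
vertices. -/
def HasNoCertificates (F : GraphClass) (g : ℕ → ℕ) (q : ℕ) : Prop :=
  ∀ (V : Type) [Finite V] (G : SimpleGraph V) (Λ : V → Finset (Fin q)),
    G ∈ F V → ¬ ListColorable G Λ →
      ∃ S : Finset V, S.card ≤ g q ∧
        ¬ ListColorable (G.induce (S : Set V)) (fun v => Λ v)

/-- `X` is a (vertex) modulator of `G` to `F`: the graph `G - X` belongs to `F`. -/
def IsModulator {V : Type} (F : GraphClass) (G : SimpleGraph V) (X : Finset V) : Prop :=
  G.induce ((X : Set V)ᶜ) ∈ F _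

/-! ### A random access machine with step count

Programs are structured programs over registers and tables that hold natural numbers, with random
access to the table entries. The operations are constants, addition, truncated subtraction and
table access, each at unit cost. There is no multiplication, so the model is polynomially
equivalent to Turing machines. -/

namespace RAM

/-- A memory state: the registers `var x` and the tables `arr a` with entries `arr a i j`. -/
structure State where
  var : ℕ → ℕ
  arr : ℕ → ℕ → ℕ → ℕ

/-- Write `v` into register `x`. -/
def State.setVar (s : State) (x v : ℕ) : State :=
  ⟨fun y => if y = x then v else s.var y, s.arr⟩

/-- Write `v` into the entry `(i, j)` of table `a`. -/
def State.setArr (s : State) (a i j v : ℕ) : State :=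
  ⟨s.var, fun a' i' j' => if a' = a ∧ i' = i ∧ j' = j then v else s.arr a' i' j'⟩

/-- Expressions. The table name in `get` is fixed by the program, its two indices are computed. -/
inductive Expr : Type
  | const (n : ℕ) : Expr
  | var (x : ℕ) : Expr
  | add (e₁ e₂ : Expr) : Expr
  | sub (e₁ e₂ : Expr) : Expr
  | get (a : ℕ) (i j : Expr) : Expr

/-- The value of an expression (`sub` is truncated subtraction). -/
def Expr.eval (s : State) : Expr → ℕ
  | .const n => n
  | .var x => s.var x
  | .add e₁ e₂ => e₁.eval s + e₂.eval s
  | .sub e₁ e₂ => e₁.eval s - e₂.eval s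
  | .get a i j => s.arr a (i.eval s) (j.eval s)

/-- The number of elementary steps needed to evaluate an expression. -/
def Expr.cost : Expr → ℕ
  | .const _ => 1
  | .var _ => 1
  | .add e₁ e₂ => e₁.cost + e₂.cost + 1
  | .sub e₁ e₂ => e₁.cost + e₂.cost + 1
  | .get _ i j => i.cost + j.cost + 1

/-- Programs. A test `e` counts as true when its value is nonzero. -/
inductive Prog : Type
  | skip : Prog
  | assign (x : ℕ) (e : Expr) : Prog
  | put (a : ℕ) (i j e : Expr) : Prog
  | seq (p₁ p₂ : Prog) : Prog
  | branch (e : Expr) (p₁ p₂ : Prog) : Prog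
  | loop (e : Expr) (p : Prog) : Prog

/-- `Exec p s t s'`: the program `p`, started in state `s`, halts after exactly `t` steps in
state `s'`. -/
inductive Exec : Prog → State → ℕ → State → Prop
  | skip (s : State) : Exec .skip s 1 s
  | assign (x : ℕ) (e : Expr) (s : State) :
      Exec (.assign x e) s (e.cost + 1) (s.setVar x (e.eval s))
  | put (a : ℕ) (i j e : Expr) (s : State) :
      Exec (.put a i j e) s (i.cost + j.cost + e.cost + 1)
        (s.setArr a (i.eval s) (j.eval s) (e.eval s))
  | seq {p₁ p₂ : Prog} {s s₁ s₂ : State} {t₁ t₂ : ℕ} :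
      Exec p₁ s t₁ s₁ → Exec p₂ s₁ t₂ s₂ → Exec (.seq p₁ p₂) s (t₁ + t₂) s₂
  | branch_true {e : Expr} {p₁ p₂ : Prog} {s s' : State} {t : ℕ} :
      e.eval s ≠ 0 → Exec p₁ s t s' → Exec (.branch e p₁ p₂) s (e.cost + 1 + t) s'
  | branch_false {e : Expr} {p₁ p₂ : Prog} {s s' : State} {t : ℕ} :
      e.eval s = 0 → Exec p₂ s t s' → Exec (.branch e p₁ p₂) s (e.cost + 1 + t) s'
  | loop_done {e : Expr} {p : Prog} {s : State} :
      e.eval s = 0 → Exec (.loop e p) s (e.cost + 1) s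
  | loop_step {e : Expr} {p : Prog} {s s₁ s₂ : State} {t₁ t₂ : ℕ} :
      e.eval s ≠ 0 → Exec p s t₁ s₁ → Exec (.loop e p) s₁ t₂ s₂ →
        Exec (.loop e p) s (e.cost + 1 + t₁ + t₂) s₂

/-- The machine is deterministic: running time and final state are determined by the program and
the initial state. -/
theorem Exec.deterministic {p : Prog} {s s₁ : State} {t₁ : ℕ} (h₁ : Exec p s t₁ s₁) :
    ∀ {s₂ : State} {t₂ : ℕ}, Exec p s t₂ s₂ → t₁ = t₂ ∧ s₁ = s₂ := by
  induction h₁ with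
  | skip s => intro s₂ t₂ h; cases h; exact ⟨rfl, rfl⟩
  | assign x e s => intro s₂ t₂ h; cases h; exact ⟨rfl, rfl⟩
  | put a i j e s => intro s₂ t₂ h; cases h; exact ⟨rfl, rfl⟩
  | seq _ _ ih₁ ih₂ =>
    intro s₂ t₂ h
    cases h with
    | seq k₁ k₂ =>
      obtain ⟨rfl, rfl⟩ := ih₁ k₁
      obtain ⟨rfl, rfl⟩ := ih₂ k₂
      exact ⟨rfl, rfl⟩
  | branch_true he _ ih =>
    intro s₂ t₂ h
    cases h with
    | branch_true _ k => obtain ⟨rfl, rfl⟩ := ih k; exact ⟨rfl, rfl⟩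
    | branch_false he' _ => exact absurd he' he
  | branch_false he _ ih =>
    intro s₂ t₂ h
    cases h with
    | branch_true he' _ => exact absurd he he'
    | branch_false _ k => obtain ⟨rfl, rfl⟩ := ih k; exact ⟨rfl, rfl⟩
  | loop_done he =>
    intro s₂ t₂ h
    cases h with
    | loop_done _ => exact ⟨rfl, rfl⟩
    | loop_step he' _ _ => exact absurd he he'
  | loop_step he _ _ ih₁ ih₂ =>
    intro s₂ t₂ h
    cases h with
    | loop_done he' => exact absurd he' he
    | loop_step _ k₁ k₂ =>
      obtain ⟨rfl, rfl⟩ := ih₁ k₁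
      obtain ⟨rfl, rfl⟩ := ih₂ k₂
      exact ⟨rfl, rfl⟩

open Classical in
/-- The 0-1 table of a relation between `Fin n` and `Fin m`, with zeros outside `n × m`. -/
noncomputable def table {n m : ℕ} (R : Fin n → Fin m → Prop) (i j : ℕ) : ℕ :=
  if ∃ (hi : i < n) (hj : j < m), R ⟨i, hi⟩ ⟨j, hj⟩ then 1 else 0

/-- The initial state for the input `(G, X)` of `q`-Coloring: register 0 holds the number of
vertices, table 0 the adjacency matrix of `G`, the first column of table 1 the indicator of `X`.
Everything else is 0. -/
noncomputable def coloringInput {n : ℕ} (G : SimpleGraph (Fin n)) (X : Finset (Fin n)) : State where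
  var x := if x = 0 then n else 0
  arr a := match a with
    | 0 => table G.Adj
    | 1 => table (fun v (_ : Fin 1) => v ∈ X)
    | _ => fun _ _ => 0

/-- The initial state for the input `(G, X, Λ)` of `q`-List-Coloring: as for `q`-Coloring, and in
addition row `v` of table 2 is the indicator of the list of `v`. -/
noncomputable def listColoringInput {n q : ℕ} (G : SimpleGraph (Fin n)) (X : Finset (Fin n))
    (Λ : Fin n → Finset (Fin q)) : State where
  var x := if x = 0 then n else 0
  arr a := match a with
    | 0 => table G.Adj
    | 1 => table (fun v (_ : Fin 1) => v ∈ X)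
    | 2 => table (fun v c => c ∈ Λ v)
    | _ => fun _ _ => 0

/-- `p`, started in state `s`, halts within at most `T` steps and answers (by a nonzero value of
register 0) whether `A` holds. -/
def Decides (p : Prog) (s : State) (A : Prop) (T : ℝ) : Prop :=
  ∃ (t : ℕ) (s' : State), Exec p s t s' ∧ (t : ℝ) ≤ T ∧ (s'.var 0 ≠ 0 ↔ A)

/-- The program `p` solves `q`-List-Coloring on `F + kv` graphs, given a modulator of size `k`, in
time `O(θ ^ k * n ^ d)`. (`n + 1` stands for `n` because the graph may have no vertices.) -/
def SolvesListColoring (p : Prog) (F : GraphClass) (q : ℕ) (θ : ℝ) (d : ℕ) : Prop :=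
  ∃ C : ℝ, ∀ (n : ℕ) (G : SimpleGraph (Fin n)) (X : Finset (Fin n)) (Λ : Fin n → Finset (Fin q)),
    IsModulator F G X →
      Decides p (listColoringInput G X Λ) (ListColorable G Λ)
        (C * θ ^ X.card * ((n : ℝ) + 1) ^ d)

/-- The program `p` solves `q`-Coloring on `F + kv` graphs, given a modulator of size `k`, in
time `O(θ ^ k * n ^ d)`. -/
def SolvesColoring (p : Prog) (F : GraphClass) (q : ℕ) (θ : ℝ) (d : ℕ) : Prop :=
  ∃ C : ℝ, ∀ (n : ℕ) (G : SimpleGraph (Fin n)) (X : Finset (Fin n)),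
    IsModulator F G X →
      Decides p (coloringInput G X) (G.Colorable q) (C * θ ^ X.card * ((n : ℝ) + 1) ^ d)

end RAM

/-!
The algorithm is a branching on the colors of the modulator `X`. Let `m = max (g q) 2`. A partial
coloring `σ` of `X` is completed by giving color `0` to all uncolored vertices. If the completion
cannot be extended to the whole graph, there are at most `m` vertices that cannot be properly
colored with the colors that remain available at them: a No-certificate in `G - X`, or one or two
vertices of `X` (`listColorable_of_tupleColorable`). For each of these vertices one vertex of `X`
is remembered: a vertex of `X` itself, and otherwise a neighbor of color `0`, since all other
missing colors were removed by vertices that `σ` colors. Hence some at most `m` uncolored vertices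
of `X` cannot all get color `0` (`not_extendable_of_not_tupleColorable`). Looking at them one by
one, the first that does not get color `0` has one of `q - 1` other colors, which gives the
branches. That only color `0` counts is what keeps the number of vertices at `m`, and the degree of
the polynomial factor independent of `q`.

For `r ≥ m` and `θ = (q ^ r - 1) ^ (1 / r)` the weights `θ ^ u`, where `u` is the number of
uncolored vertices, do not increase in total under branching (`geom_sum_le_of_pow_eq`), so that the
potential `∑ (u + 1) * θ ^ u` of the queue of pending partial colorings drops by at least one in
each round (`RAM.runs_roundProg`). It is `(k + 1) * θ ^ k` in the beginning, and a round takes time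
`O(n ^ m)`, most of it for the search through all `m`-tuples of vertices. The choice `r = m` gives
the first bound, also for `g q = 0`, and `r = g q * q` the second.

The programs are verified with a Hoare logic for total correctness with time bounds (`RAM.Runs`).
-/

/-! ### Running programs with a time bound -/

namespace RAM

@[simp] theorem State.setVar_var (s : State) (x v y : ℕ) :
    (s.setVar x v).var y = if y = x then v else s.var y := rfl

@[simp] theorem State.setVar_arr (s : State) (x v : ℕ) : (s.setVar x v).arr = s.arr := rfl

@[simp] theorem State.setArr_var (s : State) (a i j v : ℕ) : (s.setArr a i j v).var = s.var := rfl

@[simp] theorem State.setArr_arr (s : State) (a i j v a' i' j' : ℕ) :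
    (s.setArr a i j v).arr a' i' j' =
      if a' = a ∧ i' = i ∧ j' = j then v else s.arr a' i' j' := rfl

@[simp] theorem State.setArr_arr_of_ne (s : State) {a b : ℕ} (i j v : ℕ) (h : b ≠ a) :
    (s.setArr a i j v).arr b = s.arr b := by
  funext i' j'
  simp [h]

/-- Total correctness with a time bound: started in `s`, the program `p` halts within `T` steps in
a state that satisfies `Q`. -/
def Runs (p : Prog) (s : State) (T : ℕ) (Q : State → Prop) : Prop :=
  ∃ t s', Exec p s t s' ∧ t ≤ T ∧ Q s'

theorem Runs.mono {p : Prog} {s : State} {T T' : ℕ} {Q Q' : State → Prop} (h : Runs p s T Q)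
    (hT : T ≤ T') (hQ : ∀ s', Q s' → Q' s') : Runs p s T' Q' := by
  obtain ⟨t, s', h1, h2, h3⟩ := h
  exact ⟨t, s', h1, h2.trans hT, hQ _ h3⟩

theorem Runs.skip {s : State} {Q : State → Prop} (h : Q s) : Runs .skip s 1 Q :=
  ⟨1, s, .skip s, le_rfl, h⟩

theorem Runs.assign {x : ℕ} {e : Expr} {s : State} {Q : State → Prop}
    (h : Q (s.setVar x (e.eval s))) : Runs (.assign x e) s (e.cost + 1) Q :=
  ⟨_, _, .assign x e s, le_rfl, h⟩

theorem Runs.put {a : ℕ} {i j e : Expr} {s : State} {Q : State → Prop}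
    (h : Q (s.setArr a (i.eval s) (j.eval s) (e.eval s))) :
    Runs (.put a i j e) s (i.cost + j.cost + e.cost + 1) Q :=
  ⟨_, _, .put a i j e s, le_rfl, h⟩

theorem Runs.seq {p₁ p₂ : Prog} {s : State} {T₁ T₂ : ℕ} {Q : State → Prop}
    (h : Runs p₁ s T₁ fun s₁ => Runs p₂ s₁ T₂ Q) : Runs (.seq p₁ p₂) s (T₁ + T₂) Q := by
  obtain ⟨t₁, s₁, h1, h2, t₂, s₂, h3, h4, h5⟩ := h
  exact ⟨_, _, .seq h1 h3, add_le_add h2 h4, h5⟩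

theorem Runs.branch {e : Expr} {p₁ p₂ : Prog} {s : State} {T : ℕ} {Q : State → Prop}
    (h₁ : e.eval s ≠ 0 → Runs p₁ s T Q) (h₂ : e.eval s = 0 → Runs p₂ s T Q) :
    Runs (.branch e p₁ p₂) s (e.cost + 1 + T) Q := by
  by_cases he : e.eval s = 0
  · obtain ⟨t, s', h1, h2, h3⟩ := h₂ he
    exact ⟨_, _, .branch_false he h1, by omega, h3⟩
  · obtain ⟨t, s', h1, h2, h3⟩ := h₁ he
    exact ⟨_, _, .branch_true he h1, by omega, h3⟩

/-- A loop whose body lowers a nonnegative potential by at least one makes at most as many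
rounds as the potential says. -/
theorem Runs.loop {e : Expr} {p : Prog} {T : ℕ} {I : State → Prop} {Φ : State → ℝ}
    (hΦ : ∀ s, I s → 0 ≤ Φ s)
    (hp : ∀ s, I s → e.eval s ≠ 0 → Runs p s T fun s' => I s' ∧ Φ s' + 1 ≤ Φ s) :
    ∀ (N : ℕ) (s : State), I s → Φ s ≤ N →
      Runs (.loop e p) s (N * (e.cost + 1 + T) + (e.cost + 1)) fun s' => I s' ∧ e.eval s' = 0 := by
  intro N
  induction N with
  | zero =>
    intro s hs hN
    by_cases he : e.eval s = 0
    · exact ⟨_, _, .loop_done he, by omega, hs, he⟩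
    · obtain ⟨t, s', -, -, h3, h4⟩ := hp s hs he
      have := hΦ s' h3
      push_cast at hN
      linarith
  | succ N ih =>
    intro s hs hN
    by_cases he : e.eval s = 0
    · exact ⟨_, _, .loop_done he, Nat.le_add_left _ _, hs, he⟩
    · obtain ⟨t, s', h1, h2, h3, h4⟩ := hp s hs he
      push_cast at hN
      obtain ⟨t', s'', k1, k2, k3⟩ := ih s' h3 (by linarith)
      refine ⟨_, _, .loop_step he h1 k1, ?_, k3⟩
      rw [Nat.add_mul]
      omega

/-! ### Frames -/

/-- The program assigns to register `x` somewhere. -/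
def Prog.WritesVar (x : ℕ) : Prog → Prop
  | .skip => False
  | .assign y _ => x = y
  | .put _ _ _ _ => False
  | .seq p₁ p₂ => p₁.WritesVar x ∨ p₂.WritesVar x
  | .branch _ p₁ p₂ => p₁.WritesVar x ∨ p₂.WritesVar x
  | .loop _ p => p.WritesVar x

/-- The program writes to table `a` somewhere. -/
def Prog.WritesArr (a : ℕ) : Prog → Prop
  | .skip => False
  | .assign _ _ => False
  | .put b _ _ _ => a = b
  | .seq p₁ p₂ => p₁.WritesArr a ∨ p₂.WritesArr a
  | .branch _ p₁ p₂ => p₁.WritesArr a ∨ p₂.WritesArr a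
  | .loop _ p => p.WritesArr a

theorem Exec.var_eq {p : Prog} {s s' : State} {t x : ℕ} (h : Exec p s t s') :
    ¬ p.WritesVar x → s'.var x = s.var x := by
  induction h <;> simp_all [Prog.WritesVar]

theorem Exec.arr_eq {p : Prog} {s s' : State} {t a : ℕ} (h : Exec p s t s') :
    ¬ p.WritesArr a → s'.arr a = s.arr a := by
  induction h <;> simp_all [Prog.WritesArr]

/-- A program leaves alone what it does not write. -/
theorem Runs.frame {p : Prog} {s : State} {T : ℕ} {Q : State → Prop} (h : Runs p s T Q) :
    Runs p s T fun s' => Q s' ∧ (∀ x, ¬ p.WritesVar x → s'.var x = s.var x) ∧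
      ∀ a, ¬ p.WritesArr a → s'.arr a = s.arr a := by
  obtain ⟨t, s', h1, h2, h3⟩ := h
  exact ⟨t, s', h1, h2, h3, fun _ => h1.var_eq, fun _ => h1.arr_eq⟩

/-! ### Derived program constructs -/

/-- `p 0; p 1; …; p (k - 1)`, a loop unrolled when the program is written. -/
def unroll : ℕ → (ℕ → Prog) → Prog
  | 0, _ => .skip
  | k + 1, p => .seq (unroll k p) (p k)

@[simp] theorem writesVar_unroll {x k : ℕ} {p : ℕ → Prog} :
    (unroll k p).WritesVar x ↔ ∃ i < k, (p i).WritesVar x := by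
  induction k with
  | zero => simp [RAM.unroll, Prog.WritesVar]
  | succ k ih =>
    simp only [RAM.unroll, Prog.WritesVar, ih, Nat.lt_succ_iff_lt_or_eq]
    aesop

@[simp] theorem writesArr_unroll {a k : ℕ} {p : ℕ → Prog} :
    (unroll k p).WritesArr a ↔ ∃ i < k, (p i).WritesArr a := by
  induction k with
  | zero => simp [RAM.unroll, Prog.WritesArr]
  | succ k ih =>
    simp only [RAM.unroll, Prog.WritesArr, ih, Nat.lt_succ_iff_lt_or_eq]
    aesop

theorem Runs.unroll {k : ℕ} {p : ℕ → Prog} {T : ℕ} {I : ℕ → State → Prop} {s : State}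
    (h₀ : I 0 s) (hp : ∀ i < k, ∀ s', I i s' →
      (∀ y, (∀ j < k, ¬ (p j).WritesVar y) → s'.var y = s.var y) →
      (∀ a, (∀ j < k, ¬ (p j).WritesArr a) → s'.arr a = s.arr a) →
      Runs (p i) s' T (I (i + 1))) :
    Runs (unroll k p) s (k * T + 1) (I k) := by
  suffices h : ∀ l ≤ k, Runs (RAM.unroll l p) s (l * T + 1) (I l) from h k le_rfl
  intro l
  induction l with
  | zero => exact fun _ => (Runs.skip h₀).mono (by omega) fun _ h => h
  | succ l ih =>
    intro hl
    refine (Runs.seq ((ih (by omega)).frame.mono le_rfl fun s' hs' =>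
      hp l (by omega) s' hs'.1 (fun y hy => hs'.2.1 y ?_) fun a ha => hs'.2.2 a ?_)).mono ?_
        fun _ h => h
    · rw [writesVar_unroll]
      rintro ⟨j, hj, h⟩
      exact hy j (by omega) h
    · rw [writesArr_unroll]
      rintro ⟨j, hj, h⟩
      exact ha j (by omega) h
    · rw [Nat.add_mul]
      omega

/-- Run `p` with register `x` going through all numbers below the content of register 0. -/
def forAll (x : ℕ) (p : Prog) : Prog :=
  .seq (.assign x (.const 0))
    (.loop (.sub (.var 0) (.var x)) (.seq p (.assign x (.add (.var x) (.const 1)))))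

@[simp] theorem writesVar_forAll {x y : ℕ} {p : Prog} :
    (forAll x p).WritesVar y ↔ y = x ∨ p.WritesVar y := by
  simp only [forAll, Prog.WritesVar]
  tauto

@[simp] theorem writesArr_forAll {x a : ℕ} {p : Prog} :
    (forAll x p).WritesArr a ↔ p.WritesArr a := by
  simp only [forAll, Prog.WritesArr]
  tauto

theorem Runs.forAll {x n : ℕ} {p : Prog} {T : ℕ} {I : ℕ → State → Prop} {s : State}
    (hx : x ≠ 0) (hn : s.var 0 = n) (hp0 : ¬ p.WritesVar 0) (hpx : ¬ p.WritesVar x)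
    (h₀ : I 0 (s.setVar x 0))
    (hp : ∀ i < n, ∀ s', I i s' → s'.var 0 = n → s'.var x = i →
      (∀ y, y ≠ x → ¬ p.WritesVar y → s'.var y = s.var y) →
      (∀ a, ¬ p.WritesArr a → s'.arr a = s.arr a) →
      Runs p s' T fun s'' => I (i + 1) (s''.setVar x (i + 1))) :
    Runs (forAll x p) s ((n + 1) * (T + 8)) (I n) := by
  let J : State → Prop := fun s' => s'.var 0 = n ∧ s'.var x ≤ n ∧ I (s'.var x) s' ∧
    (∀ y, y ≠ x → ¬ p.WritesVar y → s'.var y = s.var y) ∧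
    ∀ a, ¬ p.WritesArr a → s'.arr a = s.arr a
  have key : Runs (.loop (.sub (.var 0) (.var x)) (.seq p (.assign x (.add (.var x) (.const 1)))))
      (s.setVar x 0) (n * (4 + (T + 4)) + 4)
      fun s' => J s' ∧ (Expr.sub (.var 0) (.var x)).eval s' = 0 := by
    refine Runs.loop (I := J) (Φ := fun s => (n : ℝ) - s.var x) (T := T + 4) ?_ ?_ n _ ?_ ?_
    · rintro s ⟨-, h2, -⟩
      have : (s.var x : ℝ) ≤ n := by exact_mod_cast h2
      linarith
    · rintro s' ⟨h1, h2, h3, hv, ha⟩ h4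
      simp only [Expr.eval] at h4
      refine Runs.seq ((hp (s'.var x) (by omega) s' h3 h1 rfl hv ha).frame.mono le_rfl ?_)
      rintro s'' ⟨k3, kv, ka⟩
      have k1 := (kv 0 hp0).trans h1
      have k2 := kv x hpx
      refine Runs.assign ?_
      simp only [J, Expr.eval, k2, State.setVar_var, if_true, if_neg hx.symm]
      refine ⟨⟨k1, by omega, k3, fun y hy hpy => ?_, fun a hpa => (ka a hpa).trans (ha a hpa)⟩, ?_⟩
      · rw [if_neg hy, kv y hpy, hv y hy hpy]
      · push_cast
        linarith
    · refine ⟨by simpa [hx.symm] using hn, by simp, by simpa using h₀, ?_, by simp⟩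
      intro y hy _
      simp [hy]
    · simp
  refine (Runs.seq (Runs.assign key)).mono ?_ ?_
  · simp only [Expr.cost]
    rw [Nat.add_mul]
    ring_nf
    omega
  · rintro s' ⟨⟨h1, h2, h3, -⟩, h4⟩
    simp only [Expr.eval] at h4
    rwa [show s'.var x = n by omega] at h3

/-! ### Boolean expressions

A number is read as a truth value: nonzero means true. -/

namespace Expr

/-- Negation. -/
def neg (e : Expr) : Expr := .sub (.const 1) e

@[simp] theorem eval_neg {s : State} {e : Expr} : e.neg.eval s ≠ 0 ↔ e.eval s = 0 := by
  simp only [neg, eval]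
  omega

/-- Disjunction of a list. -/
def any : List Expr → Expr
  | [] => .const 0
  | e :: l => .add e (any l)

@[simp] theorem eval_any {s : State} {l : List Expr} :
    (any l).eval s ≠ 0 ↔ ∃ e ∈ l, e.eval s ≠ 0 := by
  induction l with
  | nil => simp [any, eval]
  | cons e l ih =>
    simp only [any, eval, List.mem_cons, exists_eq_or_imp, ← ih]
    omega

/-- Conjunction of a list. -/
def all (l : List Expr) : Expr := (any (l.map neg)).neg

@[simp] theorem eval_all {s : State} {l : List Expr} :
    (all l).eval s ≠ 0 ↔ ∀ e ∈ l, e.eval s ≠ 0 := by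
  rw [all, eval_neg, ← not_iff_not, ← ne_eq, eval_any]
  simp only [List.mem_map, exists_exists_and_eq_and, eval_neg]
  push Not
  rfl

/-- Equality. -/
def eq (e₁ e₂ : Expr) : Expr := (add (sub e₁ e₂) (sub e₂ e₁)).neg

@[simp] theorem eval_eq {s : State} {e₁ e₂ : Expr} :
    (e₁.eq e₂).eval s ≠ 0 ↔ e₁.eval s = e₂.eval s := by
  rw [eq, eval_neg]
  simp only [eval]
  omega

end Expr

end RAM

/-! ### Partial colorings of the modulator -/

section Combinatorics

variable {n q m : ℕ}

/-- `σ` encodes a partial coloring of `X`: `0` means uncolored and `c + 1` means color `c`. Only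
vertices of `X` may be uncolored. -/
def IsPartialColoring (q : ℕ) (X : Finset (Fin n)) (σ : Fin n → ℕ) : Prop :=
  (∀ v, σ v ≤ q) ∧ ∀ v, v ∉ X → σ v ≠ 0

/-- Some proper list coloring of `G` agrees with `σ` on the colored vertices of `X`. -/
def Extendable (G : SimpleGraph (Fin n)) (X : Finset (Fin n)) (Λ : Fin n → Finset (Fin q))
    (σ : Fin n → ℕ) : Prop :=
  ∃ γ : G.Coloring (Fin q), (∀ v, γ v ∈ Λ v) ∧ ∀ v ∈ X, σ v ≠ 0 → (γ v : ℕ) = σ v - 1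

/-- Some neighbor of `v` in `X` has color `c` in the completion of `σ`, in which uncolored
vertices get color `0`. Truncated subtraction makes `σ w - 1` the color of `w` in the completion,
whether `w` is colored or not. -/
def Blocked (G : SimpleGraph (Fin n)) (X : Finset (Fin n)) (σ : Fin n → ℕ) (v : Fin n) (c : ℕ) :
    Prop :=
  ∃ w ∈ X, G.Adj v w ∧ σ w - 1 = c

/-- Color `c` remains available at `v` once `X` is colored by the completion of `σ`: a vertex of
`X` has at most its own color, any other vertex the colors of its list that are not blocked. -/
def Available (G : SimpleGraph (Fin n)) (X : Finset (Fin n)) (Λ : Fin n → Finset (Fin q))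
    (σ : Fin n → ℕ) (v : Fin n) (c : Fin q) : Prop :=
  c ∈ Λ v ∧ (v ∈ X ∧ σ v - 1 = c ∨ v ∉ X ∧ ¬ Blocked G X σ v c)

/-- The vertices of the tuple `x` can be properly colored with available colors. Equal entries of
`x` may get different colors: keeping one color for each vertex still gives a proper coloring. -/
def TupleColorable (G : SimpleGraph (Fin n)) (X : Finset (Fin n)) (Λ : Fin n → Finset (Fin q))
    (σ : Fin n → ℕ) (x : Fin m → Fin n) : Prop :=
  ∃ c : Fin m → Fin q, (∀ i, Available G X Λ σ (x i) (c i)) ∧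
    ∀ i j, c i = c j → ¬ G.Adj (x i) (x j)

/-- If all small tuples are colorable, then so is the whole graph. For `G - X` this is the
No-certificate property, and pairs suffice for the edges inside `X`. -/
theorem listColorable_of_tupleColorable {F : GraphClass} {g : ℕ → ℕ} {G : SimpleGraph (Fin n)}
    {X : Finset (Fin n)} {Λ : Fin n → Finset (Fin q)} {σ : Fin n → ℕ} (hq : 2 ≤ q)
    (hF : HasNoCertificates F g q) (hX : IsModulator F G X) (hgm : g q ≤ m) (hm : 2 ≤ m)
    (hσ : IsPartialColoring q X σ)
    (h : ∀ x : Fin m → Fin n, TupleColorable G X Λ σ x) : ListColorable G Λ := by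
  classical
  have hlt : ∀ v, σ v - 1 < q := fun v => by have := hσ.1 v; omega
  obtain ⟨δ, hδ⟩ : ListColorable (G.induce ((X : Set (Fin n))ᶜ))
      (fun v => (Λ v).filter fun c => ¬ Blocked G X σ v c) := by
    by_contra hno
    obtain ⟨S, hS, hno⟩ := hF _ _ _ hX hno
    apply hno
    obtain rfl | ⟨a, ha⟩ := S.eq_empty_or_nonempty
    · exact ⟨.mk (fun v => absurd v.2 (by simp)) fun {v} => absurd v.2 (by simp),
        fun v => absurd v.2 (by simp)⟩
    -- A tuple that runs through all of `S`.
    obtain ⟨f, hf⟩ : ∃ f : Fin m → S, Function.Surjective f := by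
      have hne : Nonempty S := ⟨⟨a, ha⟩⟩
      obtain ⟨f, hf⟩ := Function.Embedding.nonempty_of_card_le (α := S) (β := Fin m)
        (by simpa using hS.trans hgm)
      exact ⟨Function.invFun f, Function.invFun_surjective hf⟩
    obtain ⟨c, hc, hadj⟩ := h fun i => (f i : ((X : Set (Fin n))ᶜ : Set (Fin n)))
    beta_reduce at hc hadj
    choose r hr using hf
    refine ⟨SimpleGraph.Coloring.mk (fun v => c (r ⟨v, v.2⟩)) ?_, ?_⟩
    · intro v w hvw heq
      refine hadj _ _ heq ?_
      rw [hr, hr]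
      exact hvw
    · intro v
      have := hc (r ⟨v, v.2⟩)
      beta_reduce at this
      rw [hr] at this
      have hv : (v : ((X : Set (Fin n))ᶜ : Set (Fin n))).1 ∉ X :=
        fun h' => v.1.2 (by simpa using h')
      obtain ⟨h1, ⟨h2, -⟩ | ⟨-, h2⟩⟩ := this
      · exact absurd h2 hv
      · exact Finset.mem_filter.2 ⟨h1, h2⟩
  have hin : ∀ v ∈ X, (⟨σ v - 1, hlt v⟩ : Fin q) ∈ Λ v := by
    intro v hv
    obtain ⟨c, hc, -⟩ := h fun _ => v
    obtain ⟨h1, ⟨-, h2⟩ | ⟨h2, -⟩⟩ := hc ⟨0, by omega⟩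
    · convert h1
    · exact absurd hv h2
  have hprop : ∀ v ∈ X, ∀ w ∈ X, G.Adj v w → σ v - 1 ≠ σ w - 1 := by
    intro v hv w hw hvw heq
    obtain ⟨c, hc, hadj⟩ := h fun i => if i = ⟨0, by omega⟩ then v else w
    have h0 := hc ⟨0, by omega⟩
    have h1 := hc ⟨1, by omega⟩
    have h01 := hadj ⟨0, by omega⟩ ⟨1, by omega⟩
    simp only [Fin.mk.injEq, one_ne_zero, if_true, if_false] at h0 h1 h01
    obtain ⟨-, ⟨-, h0⟩ | ⟨h0, -⟩⟩ := h0
    · obtain ⟨-, ⟨-, h1⟩ | ⟨h1, -⟩⟩ := h1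
      · exact h01 (Fin.ext (by omega)) hvw
      · exact h1 hw
    · exact h0 hv
  have hmem : ∀ v, v ∉ X → v ∈ ((X : Set (Fin n))ᶜ : Set (Fin n)) := fun v hv => by simpa using hv
  have hcross : ∀ v ∈ X, ∀ w (hw : w ∉ X), G.Adj v w → σ v - 1 ≠ δ ⟨w, hmem w hw⟩ := by
    intro v hv w hw hvw heq
    exact (Finset.mem_filter.1 (hδ ⟨w, hmem w hw⟩)).2 ⟨v, hv, hvw.symm, heq⟩
  refine ⟨SimpleGraph.Coloring.mk
    (fun v => if hv : v ∈ X then ⟨σ v - 1, hlt v⟩ else δ ⟨v, hmem v hv⟩) ?_, ?_⟩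
  · intro v w hvw heq
    by_cases hv : v ∈ X <;> by_cases hw : w ∈ X <;>
      simp only [hv, hw, dif_pos, dif_neg, not_false_eq_true] at heq
    · exact hprop v hv w hw hvw (congrArg Fin.val heq)
    · exact hcross v hv w hw hvw (congrArg Fin.val heq)
    · exact hcross w hw v hv hvw.symm (congrArg Fin.val heq).symm
    · exact δ.valid (v := ⟨v, hmem v hv⟩) (w := ⟨w, hmem w hw⟩) hvw heq
  · intro v
    change (if hv : v ∈ X then (⟨σ v - 1, hlt v⟩ : Fin q) else δ ⟨v, hmem v hv⟩) ∈ Λ v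
    split_ifs with hv
    · exact hin v hv
    · exact (Finset.mem_filter.1 (hδ ⟨v, hmem v hv⟩)).1

/-- An uncolorable tuple `x` is refuted by one vertex `t i` for each entry `x i`: once all the
vertices `t i` have the color they have in the completion of `σ`, the partial coloring is not
extendable. Only a neighbor of color `0` has to be remembered for `x i`, since the blockers of the
other colors are colored by `σ` already. -/
theorem not_extendable_of_not_tupleColorable {G : SimpleGraph (Fin n)}
    {X : Finset (Fin n)} {Λ : Fin n → Finset (Fin q)} {σ σ' : Fin n → ℕ} {x t : Fin m → Fin n}
    (hx : ¬ TupleColorable G X Λ σ x) (htX : ∀ i, x i ∈ X → t i = x i)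
    (ht : ∀ i, x i ∉ X → Blocked G X σ (x i) 0 →
      t i ∈ X ∧ G.Adj (x i) (t i) ∧ σ (t i) - 1 = 0)
    (hσ : ∀ v, σ v ≠ 0 → σ' v = σ v) (hσ0 : ∀ v, σ v = 0 → σ' v ≤ 1) (hσt : ∀ i, σ' (t i) ≠ 0) :
    ¬ Extendable G X Λ σ' := by
  rintro ⟨γ, hγ, hγσ⟩
  have hsub : ∀ v, σ' v - 1 = σ v - 1 := by
    intro v
    by_cases hv : σ v = 0
    · have := hσ0 v hv
      omega
    · rw [hσ v hv]
  refine hx ⟨fun i => γ (x i), fun i => ⟨hγ _, ?_⟩, fun i j hij hadj => γ.valid hadj hij⟩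
  by_cases hi : x i ∈ X
  · have := hσt i
    rw [htX i hi] at this
    exact Or.inl ⟨hi, by rw [hγσ _ hi this, hsub]⟩
  · refine Or.inr ⟨hi, ?_⟩
    rintro ⟨w, hw, hadj, hc⟩
    by_cases hw0 : σ w - 1 = 0
    · obtain ⟨h1, h2, h3⟩ := ht i hi ⟨w, hw, hadj, hw0⟩
      have := hγσ _ h1 (hσt i)
      rw [hsub, h3, ← hw0, hc] at this
      exact γ.valid h2 (Fin.ext this.symm)
    · have hw1 : σ w ≠ 0 := by omega
      have := hγσ w hw (by rwa [hσ w hw1])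
      rw [hsub, hc] at this
      exact γ.valid hadj (Fin.ext this.symm)

/-- Branching on the color of an uncolored vertex. The branch of color `0` is listed first. -/
theorem extendable_iff_update {G : SimpleGraph (Fin n)} {X : Finset (Fin n)}
    {Λ : Fin n → Finset (Fin q)} {σ : Fin n → ℕ} {v : Fin n} (hX : v ∈ X) (hv : σ v = 0) :
    Extendable G X Λ σ ↔ Extendable G X Λ (Function.update σ v 1) ∨
      ∃ c < q - 1, Extendable G X Λ (Function.update σ v (c + 2)) := by
  have hup : ∀ (a : ℕ), Extendable G X Λ (Function.update σ v (a + 1)) ↔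
      ∃ γ : G.Coloring (Fin q), (∀ v, γ v ∈ Λ v) ∧ (∀ w ∈ X, σ w ≠ 0 → (γ w : ℕ) = σ w - 1) ∧
        (γ v : ℕ) = a := by
    intro a
    refine exists_congr fun γ => and_congr_right fun _ => ⟨fun h => ⟨fun w hw hσ => ?_, ?_⟩, ?_⟩
    · have hne : w ≠ v := by rintro rfl; exact hσ hv
      simpa [Function.update_of_ne hne, hσ] using h w hw
    · simpa using h v hX
    · rintro ⟨h1, h2⟩ w hw hne
      by_cases hwv : w = v
      · subst hwv
        simpa using h2
      · rw [Function.update_of_ne hwv] at hne ⊢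
        exact h1 w hw hne
  simp only [hup 0, hup (_ + 1)]
  constructor
  · rintro ⟨γ, h1, h2⟩
    by_cases h0 : (γ v : ℕ) = 0
    · exact Or.inl ⟨γ, h1, h2, h0⟩
    · exact Or.inr ⟨γ v - 1, by have := (γ v).2; omega, γ, h1, h2, by omega⟩
  · rintro (⟨γ, h1, h2, -⟩ | ⟨-, -, γ, h1, h2, -⟩) <;> exact ⟨γ, h1, h2⟩

/-- The number of uncolored vertices. -/
def uncolored (σ : Fin n → ℕ) : ℕ := (Finset.univ.filter fun v => σ v = 0).card

theorem uncolored_update {σ : Fin n → ℕ} {v : Fin n} (hv : σ v = 0) {a : ℕ} (ha : a ≠ 0) :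
    uncolored (Function.update σ v a) + 1 = uncolored σ := by
  classical
  have : (Finset.univ.filter fun w => Function.update σ v a w = 0) =
      (Finset.univ.filter fun w => σ w = 0).erase v := by
    ext w
    by_cases hw : w = v
    · subst hw; simp [ha]
    · simp [hw]
  rw [uncolored, uncolored, this, Finset.card_erase_add_one (by simpa using hv)]

end Combinatorics

/-! ### The branching number -/

/-- A branching with `q - 1` children of depth `i` for each `i` with `1 ≤ i ≤ e` weighs at most as
much as its root, if a node of depth `i` weighs `θ ^ (e - i)`. For `e = r` this is the choice of `θ`
and `θ ≤ q`; smaller `e` follow by downward induction. -/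
theorem geom_sum_le_of_pow_eq {q r : ℕ} {θ : ℝ} (hq : 1 ≤ q) (hθ0 : 0 < θ) (hθq : θ ≤ q)
    (hθ : θ ^ r = (q : ℝ) ^ r - 1) {e : ℕ} (he : e ≤ r) :
    ((q : ℝ) - 1) * ∑ a ∈ Finset.range e, θ ^ a ≤ θ ^ e := by
  have hq' : (0 : ℝ) ≤ q - 1 := by
    have : (1 : ℝ) ≤ q := by exact_mod_cast hq
    linarith
  induction he using Nat.decreasingInduction with
  | self =>
    rw [hθ, ← geom_sum_mul, mul_comm]
    gcongr
  | of_succ k hk ih =>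
    rw [Finset.sum_range_succ', pow_zero, mul_add, mul_one] at ih
    simp only [pow_succ _ _, ← Finset.sum_mul] at ih
    have h2 : (((q : ℝ) - 1) * ∑ a ∈ Finset.range k, θ ^ a) * θ ≤ θ ^ k * θ := by
      nlinarith
    exact le_of_mul_le_mul_right h2 hθ0

theorem rpow_root_spec {q r : ℕ} (hq : 2 ≤ q) (hr : 1 ≤ r) :
    let θ : ℝ := ((q : ℝ) ^ r - 1) ^ (1 / (r : ℝ))
    1 ≤ θ ∧ θ < q ∧ θ ^ r = (q : ℝ) ^ r - 1 := by
  intro θ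
  have hq' : (2 : ℝ) ≤ q := by exact_mod_cast hq
  have h1 : (1 : ℝ) ≤ (q : ℝ) ^ r - 1 := by
    have : (q : ℝ) ≤ q ^ r := le_self_pow₀ (by linarith) (by omega)
    linarith
  have hpow : θ ^ r = (q : ℝ) ^ r - 1 := by
    simp only [θ, one_div]
    exact Real.rpow_inv_natCast_pow (by linarith) (by omega)
  refine ⟨Real.one_le_rpow h1 (by positivity), ?_, hpow⟩
  exact lt_of_pow_lt_pow_left₀ r (by linarith) (by rw [hpow]; linarith)

/-! ### The branching program -/

namespace RAM

/-- The register that holds the `i`-th entry of the tuple that is examined. -/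
def tupleReg (i : ℕ) : ℕ := 10 + 2 * i

/-- The register that holds the `i`-th vertex to branch on. -/
def branchReg (i : ℕ) : ℕ := 11 + 2 * i

/-- Fill table 4: entry `(v, c)` becomes `w + 1` for some neighbor `w` of `v` in `X` that has color
`c` in the completion of the partial coloring in row `var 1` of table 3, and `0` if there is
none. -/
def blockProg (q : ℕ) : Prog :=
  forAll 5 (.seq (unroll q fun c => .put 4 (.var 5) (.const c) (.const 0))
    (forAll 6 (.branch (.all [.get 1 (.var 6) (.const 0), .get 0 (.var 5) (.var 6)])
      (.put 4 (.var 5) (.sub (.get 3 (.var 1) (.var 6)) (.const 1)) (.add (.var 6) (.const 1)))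
      .skip)))

/-- Color `c` is available at the `i`-th vertex of the tuple. -/
def availableExpr (i c : ℕ) : Expr :=
  .all [.get 2 (.var (tupleReg i)) (.const c), .any [
    .all [.get 1 (.var (tupleReg i)) (.const 0),
      .eq (.sub (.get 3 (.var 1) (.var (tupleReg i))) (.const 1)) (.const c)],
    .all [.neg (.get 1 (.var (tupleReg i)) (.const 0)),
      .neg (.get 4 (.var (tupleReg i)) (.const c))]]]

/-- The `m`-tuple is colorable: a disjunction over all `q ^ m` colorings. -/
noncomputable def tupleExpr (m q : ℕ) : Expr :=
  .any ((Finset.univ : Finset (Fin m → Fin q)).toList.map fun c => .all [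
    .all ((List.finRange m).map fun i : Fin m => availableExpr i (c i)),
    .all ((List.finRange m).map fun i : Fin m => .all ((List.finRange m).map fun j : Fin m =>
      if c i = c j then .neg (.get 0 (.var (tupleReg i)) (.var (tupleReg j))) else .const 1))])

/-- If the tuple is not colorable, set the flag in register 4 and record the vertices to branch
on. For an unblocked entry outside of `X` the recorded vertex is `0 - 1 = 0`, which is harmless. -/
noncomputable def checkProg (m q : ℕ) : Prog :=
  .branch (tupleExpr m q) .skip (.seq (.assign 4 (.const 1)) (unroll m fun i =>
    .branch (.get 1 (.var (tupleReg i)) (.const 0))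
      (.assign (branchReg i) (.var (tupleReg i)))
      (.assign (branchReg i) (.sub (.get 4 (.var (tupleReg i)) (.const 0)) (.const 1)))))

/-- Run `p` for all values of the first `k` entries of the tuple. -/
def forAllTuples : ℕ → Prog → Prog
  | 0, p => p
  | k + 1, p => forAll (tupleReg k) (forAllTuples k p)

/-- Look for a tuple that is not colorable. -/
noncomputable def searchProg (m q : ℕ) : Prog :=
  .seq (.assign 4 (.const 0)) (forAllTuples m (checkProg m q))

/-- Append to the queue a copy of the current row in which the `i`-th branching vertex has color
`c + 1`. -/
def childProg (i c : ℕ) : Prog :=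
  .seq (forAll 5 (.put 3 (.var 2) (.var 5) (.get 3 (.var 1) (.var 5))))
    (.seq (.put 3 (.var 2) (.var (branchReg i)) (.const (c + 2)))
      (.assign 2 (.add (.var 2) (.const 1))))

/-- For each uncolored branching vertex in turn: append one child for each color other than `0`,
and give it color `0` in the current row. -/
def expandProg (m q : ℕ) : Prog :=
  unroll m fun i => .branch (.get 3 (.var 1) (.var (branchReg i))) .skip
    (.seq (unroll (q - 1) (childProg i)) (.put 3 (.var 1) (.var (branchReg i)) (.const 1)))

/-- Process the partial coloring at the head of the queue. -/
noncomputable def roundProg (m q : ℕ) : Prog :=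
  .seq (blockProg q) (.seq (searchProg m q)
    (.seq (.branch (.var 4) (expandProg m q) (.assign 3 (.const 1)))
      (.assign 1 (.add (.var 1) (.const 1)))))

/-- The algorithm for list coloring. The rows of table 3 from `var 1` up to `var 2` (exclusive) are
the queue of partial colorings; register 3 holds the answer. Processed rows stay in the table. The
first row leaves all of `X` uncolored; the value `1` at the other vertices keeps the program from
branching on them. -/
noncomputable def listColoringProg (m q : ℕ) : Prog :=
  .seq (forAll 5 (.put 3 (.const 0) (.var 5) (.neg (.get 1 (.var 5) (.const 0)))))
    (.seq (.assign 1 (.const 0)) (.seq (.assign 2 (.const 1)) (.seq (.assign 3 (.const 0))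
      (.seq (.loop (.sub (.var 2) (.var 1)) (roundProg m q)) (.assign 0 (.var 3))))))

/-- The algorithm for coloring: make all lists full. -/
noncomputable def coloringProg (m q : ℕ) : Prog :=
  .seq (forAll 5 (unroll q fun c => .put 2 (.var 5) (.const c) (.const 1))) (listColoringProg m q)

/-! ### Specification of the search for an uncolorable tuple -/

variable {n q m : ℕ}

/-- The state holds the instance `(G, X, Λ)`. -/
structure Holds (G : SimpleGraph (Fin n)) (X : Finset (Fin n)) (Λ : Fin n → Finset (Fin q))
    (s : State) : Prop where
  var_zero : s.var 0 = n
  adj : ∀ v w : Fin n, s.arr 0 v w ≠ 0 ↔ G.Adj v w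
  mem : ∀ v : Fin n, s.arr 1 v 0 ≠ 0 ↔ v ∈ X
  list : ∀ (v : Fin n) (c : Fin q), s.arr 2 v c ≠ 0 ↔ c ∈ Λ v

theorem Holds.congr {G : SimpleGraph (Fin n)} {X : Finset (Fin n)} {Λ : Fin n → Finset (Fin q)}
    {s s' : State} (h : Holds G X Λ s) (h0 : s'.var 0 = s.var 0) (ha0 : s'.arr 0 = s.arr 0)
    (ha1 : s'.arr 1 = s.arr 1) (ha2 : s'.arr 2 = s.arr 2) : Holds G X Λ s' :=
  ⟨h0.trans h.1, by rw [ha0]; exact h.2, by rw [ha1]; exact h.3, by rw [ha2]; exact h.4⟩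

/-- The partial coloring in row `i` of table 3. -/
def row (n : ℕ) (s : State) (i : ℕ) : Fin n → ℕ := fun v => s.arr 3 i v

/-- The entry `(v, c)` of table 4 is `a` when the neighbors below `k` have been looked at. -/
def BlockEntry (G : SimpleGraph (Fin n)) (X : Finset (Fin n)) (σ : Fin n → ℕ) (k : ℕ) (v : Fin n)
    (c a : ℕ) : Prop :=
  (a = 0 → ∀ w ∈ X, (w : ℕ) < k → G.Adj v w → σ w - 1 ≠ c) ∧
    (a ≠ 0 → ∃ w ∈ X, G.Adj v w ∧ σ w - 1 = c ∧ a = w + 1)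

/-- Table 4 has been filled. -/
def BlockTable (G : SimpleGraph (Fin n)) (X : Finset (Fin n)) (q : ℕ) (σ : Fin n → ℕ) (s : State) :
    Prop :=
  ∀ (v : Fin n), ∀ c < q, BlockEntry G X σ n v c (s.arr 4 v c)

theorem BlockTable.blocked_iff {G : SimpleGraph (Fin n)} {X : Finset (Fin n)} {σ : Fin n → ℕ}
    {s : State} (h : BlockTable G X q σ s) (v : Fin n) {c : ℕ} (hc : c < q) :
    Blocked G X σ v c ↔ s.arr 4 v c ≠ 0 := by
  constructor
  · rintro ⟨w, hw, hadj, hc'⟩ h0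
    exact (h v c hc).1 h0 w hw w.2 hadj hc'
  · intro h0
    obtain ⟨w, hw, hadj, hc', -⟩ := (h v c hc).2 h0
    exact ⟨w, hw, hadj, hc'⟩

theorem runs_blockProg (q : ℕ) : ∃ K : ℕ, ∀ (n : ℕ) (G : SimpleGraph (Fin n)) (X : Finset (Fin n))
    (Λ : Fin n → Finset (Fin q)) (s : State), Holds G X Λ s →
      Runs (blockProg q) s (K * (n + 1) ^ 2) (BlockTable G X q (row n s (s.var 1))) := by
  refine ⟨q * 4 + 100, fun n G X Λ s hs => ?_⟩
  set σ := row n s (s.var 1) with hσ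
  refine (Runs.forAll (T := (q * 4 + 1) + (n + 1) * (30 + 8))
    (I := fun i s' => ∀ v : Fin n, (v : ℕ) < i → ∀ c < q, BlockEntry G X σ n v c (s'.arr 4 v c))
    (by norm_num) hs.1 ?_ ?_ (by simp) ?_).mono ?_ ?_
  · simp [Prog.WritesVar]
  · simp [Prog.WritesVar]
  · intro i hi s₁ h₁ hn₁ hi₁ hv₁ ha₁
    have hv : s₁.var 1 = s.var 1 := hv₁ 1 (by norm_num) (by simp [Prog.WritesVar])
    have ha : ∀ a, a ≠ 4 → s₁.arr a = s.arr a := fun a ha => ha₁ a (by simp [Prog.WritesArr, ha])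
    refine Runs.seq ((Runs.unroll (T := 4)
      (I := fun c s' => (∀ v : Fin n, (v : ℕ) < i → ∀ c < q, BlockEntry G X σ n v c (s'.arr 4 v c)) ∧
        ∀ c' < c, s'.arr 4 i c' = 0) ⟨h₁, by simp⟩ ?_).frame.mono le_rfl ?_)
    · rintro c hc s₂ ⟨h₂, h₂'⟩ hv₂ -
      have := hv₂ 5 (by simp [Prog.WritesVar])
      refine Runs.put ?_
      simp only [Expr.eval, State.setArr_arr, this, hi₁, true_and]
      refine ⟨fun v hvi c' hc' => ?_, fun c' hc' => ?_⟩
      · rw [if_neg (by omega)]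
        exact h₂ v hvi c' hc'
      · split_ifs with h
        · rfl
        · exact h₂' c' (by omega)
    · rintro s₂ ⟨⟨h₂, h₂'⟩, hv₂, ha₂⟩
      have hv' : ∀ y, s₂.var y = s₁.var y := fun y => hv₂ y (by simp [Prog.WritesVar])
      have ha' : ∀ a, a ≠ 4 → s₂.arr a = s.arr a := fun a ha'' =>
        (ha₂ a (by simp [Prog.WritesArr, ha''])).trans (ha a ha'')
      refine (Runs.forAll (T := 30)
        (I := fun j s' =>
          (∀ v : Fin n, (v : ℕ) < i → ∀ c < q, BlockEntry G X σ n v c (s'.arr 4 v c)) ∧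
          ∀ c < q, BlockEntry G X σ j ⟨i, hi⟩ c (s'.arr 4 i c))
        (by norm_num) ((hv' 0).trans hn₁) ?_ ?_ ⟨by simpa using h₂, ?_⟩ ?_).mono le_rfl ?_
      · simp [Prog.WritesVar]
      · simp [Prog.WritesVar]
      · intro c hc
        simp only [State.setVar_arr, h₂' c hc]
        exact ⟨fun _ w _ hw => absurd hw (by omega), fun h => absurd rfl h⟩
      · rintro j hj s₃ ⟨h₃, h₃'⟩ hn₃ hj₃ hv₃ ha₃
        have hv3 : ∀ y, y ≠ 6 → s₃.var y = s₁.var y := fun y hy =>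
          (hv₃ y hy (by simp [Prog.WritesVar])).trans (hv' y)
        have ha3 : ∀ a, a ≠ 4 → s₃.arr a = s.arr a := fun a ha'' =>
          (ha₃ a (by simp [Prog.WritesArr, ha''])).trans (ha' a ha'')
        have hc : (Expr.all [.get 1 (.var 6) (.const 0), .get 0 (.var 5) (.var 6)]).eval s₃ ≠ 0 ↔
            (⟨j, hj⟩ : Fin n) ∈ X ∧ G.Adj ⟨i, hi⟩ ⟨j, hj⟩ := by
          rw [← hs.mem, ← hs.adj]
          simp [Expr.eval, ha3, hv3, hi₁, hj₃]
        refine (Runs.branch (T := 10) (fun he => (Runs.put ?_).mono (by simp [Expr.cost])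
          fun _ h => h) (fun he => (Runs.skip ?_).mono (by norm_num)
          fun _ h => h)).mono (by simp [Expr.cost, Expr.all, Expr.any, Expr.neg]) fun _ h => h
        · obtain ⟨hjX, hij⟩ := hc.1 he
          have hval : s₃.arr 3 (s₃.var 1) j = σ ⟨j, hj⟩ := by
            rw [ha3 3 (by norm_num), hv3 1 (by norm_num), hv]
            rfl
          simp only [Expr.eval, State.setVar_arr, State.setArr_arr, hv3 5 (by norm_num), hi₁, hj₃,
            hval, true_and]
          refine ⟨fun v hvi c hc => ?_, fun c hc => ?_⟩
          · rw [if_neg (by omega)]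
            exact h₃ v hvi c hc
          · split_ifs with hcj
            · exact ⟨fun h => by omega, fun _ => ⟨⟨j, hj⟩, hjX, hij, hcj.symm, rfl⟩⟩
            · refine ⟨fun h w hw hwj hadj => ?_, (h₃' c hc).2⟩
              by_cases hwj' : (w : ℕ) = j
              · have : w = ⟨j, hj⟩ := Fin.ext hwj'
                rw [this]
                exact fun h => hcj h.symm
              · exact (h₃' c hc).1 h w hw (by omega) hadj
        · have hno : ¬ _ := fun h => (hc.2 h) he
          refine ⟨h₃, fun c hc => ⟨fun h w hw hwj hadj => ?_, (h₃' c hc).2⟩⟩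
          by_cases hwj' : (w : ℕ) = j
          · have : w = ⟨j, hj⟩ := Fin.ext hwj'
            rw [this] at hw hadj
            exact absurd ⟨hw, hadj⟩ hno
          · exact (h₃' c hc).1 h w hw (by omega) hadj
      · rintro s₃ ⟨h₃, h₃'⟩ v hvi c hc
        by_cases h : (v : ℕ) = i
        · have : v = ⟨i, hi⟩ := Fin.ext h
          subst this
          exact h₃' c hc
        · exact h₃ v (by omega) c hc
  · nlinarith [Nat.zero_le n, Nat.zero_le q, Nat.zero_le (n * q), Nat.zero_le (n * n * q)]
  · exact fun s' h v => h v v.2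

theorem tupleExpr_eval {G : SimpleGraph (Fin n)} {X : Finset (Fin n)}
    {Λ : Fin n → Finset (Fin q)} {s : State} (hs : Holds G X Λ s)
    (hB : BlockTable G X q (row n s (s.var 1)) s) {x : Fin m → Fin n}
    (hx : ∀ i : Fin m, s.var (tupleReg i) = x i) :
    (tupleExpr m q).eval s ≠ 0 ↔ TupleColorable G X Λ (row n s (s.var 1)) x := by
  have hif : ∀ (c : Fin m → Fin q) (i j : Fin m),
      (if c i = c j then Expr.neg (.get 0 (.var (tupleReg i)) (.var (tupleReg j)))
        else .const 1).eval s ≠ 0 ↔ (c i = c j → ¬ G.Adj (x i) (x j)) := by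
    intro c i j
    rw [← hs.adj]
    split_ifs with h
    · rw [Expr.eval_neg]
      simp [Expr.eval, hx, h]
    · simp [Expr.eval, h]
  have hav : ∀ (i : Fin m) (c : Fin q), (availableExpr i c).eval s ≠ 0 ↔
      Available G X Λ (row n s (s.var 1)) (x i) c := by
    intro i c
    simp only [availableExpr, Expr.eval_all, Expr.eval_any, List.mem_cons, List.not_mem_nil,
      or_false, forall_eq_or_imp, forall_eq, exists_eq_or_imp, exists_eq_left, Expr.eval_eq,
      Expr.eval_neg, Expr.eval, hx, Available, ← hs.list, ← hs.mem, hB.blocked_iff _ c.2, row,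
      not_not, ne_eq]
  unfold tupleExpr TupleColorable
  simp only [Expr.eval_any, Expr.eval_all, List.mem_map, Finset.mem_toList, Finset.mem_univ,
    true_and, exists_exists_eq_and, List.mem_cons, List.not_mem_nil, or_false, forall_eq_or_imp,
    forall_eq, List.mem_finRange, forall_exists_index, forall_apply_eq_imp_iff, hav, hif]

/-- The vertices in the branching registers come from an uncolorable tuple, as in
`not_extendable_of_not_tupleColorable`. -/
def IsBranching (G : SimpleGraph (Fin n)) (X : Finset (Fin n)) (Λ : Fin n → Finset (Fin q)) (m : ℕ)
    (σ : Fin n → ℕ) (s : State) : Prop :=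
  ∃ x t : Fin m → Fin n, ¬ TupleColorable G X Λ σ x ∧ (∀ i : Fin m, s.var (branchReg i) = t i) ∧
    (∀ i, x i ∈ X → t i = x i) ∧ ∀ i, x i ∉ X → Blocked G X σ (x i) 0 →
      t i ∈ X ∧ G.Adj (x i) (t i) ∧ σ (t i) - 1 = 0

theorem runs_checkProg (m : ℕ) {q : ℕ} (hq : 0 < q) : ∃ K : ℕ, ∀ (n : ℕ) (G : SimpleGraph (Fin n))
    (X : Finset (Fin n)) (Λ : Fin n → Finset (Fin q)) (s : State), Holds G X Λ s →
      BlockTable G X q (row n s (s.var 1)) s →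
      ∀ x : Fin m → Fin n, (∀ i : Fin m, s.var (tupleReg i) = x i) →
        (s.var 4 ≠ 0 → IsBranching G X Λ m (row n s (s.var 1)) s) →
        Runs (checkProg m q) s K fun s' =>
          (s'.var 4 ≠ 0 → IsBranching G X Λ m (row n s (s.var 1)) s') ∧
          (s'.var 4 = 0 → s.var 4 = 0 ∧ TupleColorable G X Λ (row n s (s.var 1)) x) := by
  refine ⟨(tupleExpr m q).cost + 1 + (2 + (m * 10 + 1)), fun n G X Λ s hs hB x hx hb => ?_⟩
  refine Runs.branch (fun he => ?_) fun he => ?_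
  · exact (Runs.skip ⟨hb, fun h => ⟨h, (tupleExpr_eval hs hB hx).1 he⟩⟩).mono (by omega) fun _ h => h
  · have hno : ¬ TupleColorable G X Λ (row n s (s.var 1)) x :=
      fun h => (tupleExpr_eval hs hB hx).2 h he
    let t : Fin m → ℕ := fun i => if x i ∈ X then x i else s.arr 4 (x i) 0 - 1
    refine Runs.seq (Runs.assign ((Runs.unroll (T := 10)
      (I := fun k s' => s'.var 4 = 1 ∧ ∀ i : Fin m, (i : ℕ) < k → s'.var (branchReg i) = t i)
      ⟨by simp [Expr.eval], by simp⟩ ?_).mono le_rfl ?_))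
    · rintro i hi s₁ ⟨h₁, h₁'⟩ hv ha
      have harr : s₁.arr = s.arr := funext fun a => by
        rw [ha a (by simp [Prog.WritesArr])]
        rfl
      have hvar : s₁.var (tupleReg i) = x ⟨i, hi⟩ := by
        rw [hv _ (by simp [Prog.WritesVar, tupleReg, branchReg]; omega), ← hx]
        simp [tupleReg, show 10 + 2 * i ≠ 4 by omega]
      have hset : ∀ a, a = t ⟨i, hi⟩ → (s₁.setVar (branchReg i) a).var 4 = 1 ∧
          ∀ j : Fin m, (j : ℕ) < i + 1 → (s₁.setVar (branchReg i) a).var (branchReg j) = t j := by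
        rintro a rfl
        refine ⟨by simpa [branchReg, show 4 ≠ 11 + 2 * i by omega] using h₁, fun j hj => ?_⟩
        by_cases hji : (j : ℕ) = i
        · have : j = ⟨i, hi⟩ := Fin.ext hji
          subst this
          simp
        · rw [State.setVar_var, if_neg (by simp [branchReg]; omega)]
          exact h₁' j (by omega)
      have hmem : (Expr.get 1 (.var (tupleReg i)) (.const 0)).eval s₁ ≠ 0 ↔ x ⟨i, hi⟩ ∈ X := by
        simp only [Expr.eval, hvar, harr, hs.mem]
      refine (Runs.branch (T := 6)
        (fun hc => (Runs.assign (hset _ ?_)).mono (by simp [Expr.cost]) fun _ h => h)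
        (fun hc => (Runs.assign (hset _ ?_)).mono (by simp [Expr.cost]) fun _ h => h)).mono
        (by simp [Expr.cost]) fun _ h => h
      · simp [Expr.eval, hvar, t, hmem.1 hc]
      · have : x ⟨i, hi⟩ ∉ X := fun h => (hmem.2 h) hc
        simp [Expr.eval, hvar, harr, t, this]
    · rintro s₁ ⟨h₁, h₁'⟩
      refine ⟨fun _ => ?_, fun h => by omega⟩
      have ht : ∀ i, t i < n := by
        intro i
        simp only [t]
        split_ifs with hi
        · exact (x i).2
        · by_cases h0 : s.arr 4 (x i) 0 = 0
          · rw [h0]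
            exact (Nat.zero_le _).trans_lt (x i).2
          · obtain ⟨w, -, -, -, hw⟩ := (hB (x i) 0 hq).2 h0
            rw [hw]
            exact w.2
      refine ⟨x, fun i => ⟨t i, ht i⟩, hno, fun i => h₁' i i.2, fun i hi => Fin.ext (if_pos hi),
        fun i hi hbl => ?_⟩
      obtain ⟨w, h1, h2, h3, hw⟩ := (hB (x i) 0 hq).2 ((hB.blocked_iff _ hq).1 hbl)
      have : (⟨t i, ht i⟩ : Fin n) = w := Fin.ext (by simp [t, hi, hw])
      beta_reduce
      rw [this]
      exact ⟨h1, h2, h3⟩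

theorem not_writesVar_checkProg {y : ℕ} (hy : y < 10) (hy4 : y ≠ 4) :
    ¬ (checkProg m q).WritesVar y := by
  simp only [checkProg, Prog.WritesVar, writesVar_unroll, branchReg]
  rintro (h | h | ⟨i, -, h | h⟩) <;> omega

theorem not_writesVar_checkProg_tupleReg {i : ℕ} : ¬ (checkProg m q).WritesVar (tupleReg i) := by
  simp only [checkProg, Prog.WritesVar, writesVar_unroll, branchReg, tupleReg]
  rintro (h | h | ⟨i, -, h | h⟩) <;> omega

theorem not_writesArr_checkProg {a : ℕ} : ¬ (checkProg m q).WritesArr a := by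
  simp [checkProg, Prog.WritesArr]

theorem writesVar_forAllTuples {k y : ℕ} {p : Prog} :
    (forAllTuples k p).WritesVar y ↔ (∃ i < k, y = tupleReg i) ∨ p.WritesVar y := by
  induction k with
  | zero => simp [forAllTuples]
  | succ k ih =>
    simp only [forAllTuples, writesVar_forAll, ih, Nat.lt_succ_iff_lt_or_eq]
    aesop

theorem writesArr_forAllTuples {k a : ℕ} {p : Prog} :
    (forAllTuples k p).WritesArr a ↔ p.WritesArr a := by
  induction k with
  | zero => rfl
  | succ k ih => rw [forAllTuples, writesArr_forAll, ih]

/-- Nested loops over all tuples. The body establishes `P x` for the tuple `x` or sets the flag in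
register 4, which is never reset. -/
theorem Runs.forAllTuples {p : Prog} {T : ℕ} {I : State → Prop} {P : (ℕ → ℕ) → Prop}
    (hI0 : ∀ s, I s → s.var 0 = n) (hI : ∀ s i a, I s → I (s.setVar (tupleReg i) a))
    (hp0 : ¬ p.WritesVar 0) (hpt : ∀ i, ¬ p.WritesVar (tupleReg i))
    (hp : ∀ s, I s → (∀ i < m, s.var (tupleReg i) < n) → Runs p s T fun s' =>
      I s' ∧ (s'.var 4 = 0 → s.var 4 = 0 ∧ P fun i => s.var (tupleReg i)))
    (k : ℕ) (hk : k ≤ m) (s : State) (hs : I s)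
    (hlt : ∀ i, k ≤ i → i < m → s.var (tupleReg i) < n) :
    Runs (forAllTuples k p) s ((n + 1) ^ k * (T + 8 * k)) fun s' => I s' ∧
      (s'.var 4 = 0 → s.var 4 = 0 ∧ ∀ x : ℕ → ℕ, (∀ i < k, x i < n) →
        (∀ i, k ≤ i → x i = s.var (tupleReg i)) → P x) := by
  induction k generalizing s with
  | zero =>
    refine (hp s hs fun i => hlt i (Nat.zero_le i)).mono (by simp) ?_
    rintro s' ⟨h1, h2⟩
    refine ⟨h1, fun h => ⟨(h2 h).1, fun x _ hx => ?_⟩⟩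
    rw [show x = _ from funext fun i => hx i (Nat.zero_le i)]
    exact (h2 h).2
  | succ k ih =>
    have htr : ∀ i j, tupleReg i = tupleReg j ↔ i = j := fun i j => by simp [tupleReg]
    refine (Runs.forAll (T := (n + 1) ^ k * (T + 8 * k)) (I := fun j s' => I s' ∧
      (s'.var 4 = 0 → s.var 4 = 0 ∧ ∀ x : ℕ → ℕ, (∀ i < k, x i < n) → x k < j →
        (∀ i, k + 1 ≤ i → x i = s.var (tupleReg i)) → P x))
      (by simp [tupleReg]) (hI0 s hs) ?_ ?_ ⟨hI _ _ _ hs, ?_⟩ ?_).mono ?_ ?_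
    · rw [writesVar_forAllTuples]
      rintro (⟨i, -, h⟩ | h)
      · rw [tupleReg] at h
        omega
      · exact hp0 h
    · rw [writesVar_forAllTuples]
      simp only [hpt, htr, or_false, not_exists, not_and]
      intro i hi h
      omega
    · simp [tupleReg, show 4 ≠ 10 + 2 * k by omega]
    · rintro j hj s₁ ⟨h₁, h₁'⟩ - hjv hv -
      have hvi : ∀ i, k + 1 ≤ i → s₁.var (tupleReg i) = s.var (tupleReg i) := by
        intro i hi
        refine hv _ (by rw [Ne, htr]; omega) ?_
        rw [writesVar_forAllTuples]
        simp only [hpt, htr, or_false, not_exists, not_and]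
        intro i' hi' h
        omega
      refine (ih (by omega) s₁ h₁ ?_).mono le_rfl ?_
      · intro i hki him
        obtain rfl | hki := hki.eq_or_lt
        · rwa [hjv]
        · rw [hvi i hki]
          exact hlt i hki him
      · rintro s₂ ⟨h₂, h₂'⟩
        refine ⟨hI _ _ _ h₂, fun h4 => ?_⟩
        rw [State.setVar_var, if_neg (by simp [tupleReg]; omega)] at h4
        obtain ⟨h41, hP2⟩ := h₂' h4
        obtain ⟨h40, hP1⟩ := h₁' h41
        refine ⟨h40, fun x hx hxk hxi => ?_⟩
        obtain hxk | hxk := Nat.lt_succ_iff_lt_or_eq.1 hxk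
        · exact hP1 x hx hxk hxi
        · refine hP2 x hx fun i hi => ?_
          obtain rfl | hi := hi.eq_or_lt
          · rw [hxk, hjv]
          · rw [hxi i hi, hvi i hi]
    · calc (n + 1) * ((n + 1) ^ k * (T + 8 * k) + 8)
          ≤ (n + 1) * ((n + 1) ^ k * (T + 8 * k) + (n + 1) ^ k * 8) := by
            gcongr
            exact Nat.le_mul_of_pos_left _ (by positivity)
        _ = _ := by ring
    · rintro s' ⟨h1, h2⟩
      exact ⟨h1, fun h => ⟨(h2 h).1, fun x hx => (h2 h).2 x (fun i hi => hx i (by omega))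
        (hx k (by omega))⟩⟩

theorem runs_searchProg (m : ℕ) {q : ℕ} (hq : 0 < q) : ∃ K : ℕ, ∀ (n : ℕ) (G : SimpleGraph (Fin n))
    (X : Finset (Fin n)) (Λ : Fin n → Finset (Fin q)) (s : State), Holds G X Λ s →
      BlockTable G X q (row n s (s.var 1)) s →
        Runs (searchProg m q) s (K * (n + 1) ^ m) fun s' =>
          (s'.var 4 ≠ 0 → IsBranching G X Λ m (row n s (s.var 1)) s') ∧
          (s'.var 4 = 0 → ∀ x : Fin m → Fin n, TupleColorable G X Λ (row n s (s.var 1)) x) := by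
  obtain ⟨K, hK⟩ := runs_checkProg m hq
  refine ⟨2 + (K + 8 * m), fun n G X Λ s hs hB => ?_⟩
  set σ := row n s (s.var 1) with hσ
  refine (Runs.seq (Runs.assign ((Runs.forAllTuples (m := m) (n := n) (T := K)
    (I := fun s' => (s'.arr = s.arr ∧ s'.var 0 = s.var 0 ∧ s'.var 1 = s.var 1) ∧
      (s'.var 4 ≠ 0 → IsBranching G X Λ m σ s'))
    (P := fun x => ∀ y : Fin m → Fin n, (∀ i : Fin m, (y i : ℕ) = x i) → TupleColorable G X Λ σ y)
    (fun s' h => h.1.2.1.trans hs.1) ?_ (not_writesVar_checkProg (by norm_num) (by norm_num))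
    (fun _ => not_writesVar_checkProg_tupleReg) ?_ m le_rfl _ ?_ ?_).mono le_rfl ?_))).mono ?_
    fun _ h => h
  · rintro s' i a ⟨⟨h1, h2, h3⟩, h4⟩
    have e : ∀ y, y < 10 → (s'.setVar (tupleReg i) a).var y = s'.var y := fun y hy => by
      rw [State.setVar_var, if_neg (by simp [tupleReg]; omega)]
    refine ⟨⟨h1, (e 0 (by norm_num)).trans h2, (e 1 (by norm_num)).trans h3⟩, fun h => ?_⟩
    rw [e 4 (by norm_num)] at h
    obtain ⟨x, t, k1, k2, k3⟩ := h4 h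
    refine ⟨x, t, k1, fun j => ?_, k3⟩
    rw [State.setVar_var, if_neg (by simp [tupleReg, branchReg]; omega), k2]
  · rintro s' ⟨⟨h1, h2, h3⟩, h4⟩ hlt
    have hrow : row n s' (s'.var 1) = σ := by rw [hσ]; funext v; simp [row, h1, h3]
    have hs' : Holds G X Λ s' := hs.congr h2 (by rw [h1]) (by rw [h1]) (by rw [h1])
    have := hK n G X Λ s' hs' (by rw [hrow, BlockTable, h1]; exact hB)
      (fun i => ⟨s'.var (tupleReg i), hlt i i.2⟩) (fun i => rfl) (by rwa [hrow])
    rw [hrow] at this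
    refine this.frame.mono le_rfl ?_
    rintro s'' ⟨⟨k1, k2⟩, kv, ka⟩
    refine ⟨⟨⟨(funext fun a => ka a not_writesArr_checkProg).trans h1,
      (kv 0 (not_writesVar_checkProg (by norm_num) (by norm_num))).trans h2,
      (kv 1 (not_writesVar_checkProg (by norm_num) (by norm_num))).trans h3⟩, k1⟩, fun h => ?_⟩
    refine ⟨(k2 h).1, fun y hy => ?_⟩
    rw [show y = fun i => ⟨s'.var (tupleReg i), hlt i i.2⟩ from funext fun i => Fin.ext (hy i)]
    exact (k2 h).2
  · simp [Expr.eval]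
  · intro i h1 h2
    omega
  · rintro s' ⟨⟨-, h1⟩, h2⟩
    refine ⟨h1, fun h x => ?_⟩
    refine (h2 h).2 (fun i => if hi : i < m then x ⟨i, hi⟩ else
      (s.setVar 4 ((Expr.const 0).eval s)).var (tupleReg i)) (fun i hi => ?_) (fun i hi => ?_) x
      fun i => ?_
    · simp [hi]
    · rw [dif_neg (by omega)]
    · simp
  · have : 1 ≤ (n + 1) ^ m := Nat.one_le_pow _ _ (by omega)
    simp only [Expr.cost]
    nlinarith

end RAM

namespace RAM

variable {n q m : ℕ}

/-! ### Specification of the branching step -/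

theorem writesVar_childProg {i c y : ℕ} : (childProg i c).WritesVar y ↔ y = 5 ∨ y = 2 := by
  simp [childProg, Prog.WritesVar]

theorem writesArr_childProg {i c a : ℕ} : (childProg i c).WritesArr a ↔ a = 3 := by
  simp [childProg, Prog.WritesArr]

theorem writesVar_expandProg {y : ℕ} (h : (expandProg m q).WritesVar y) : y = 5 ∨ y = 2 := by
  simp only [expandProg, Prog.WritesVar, writesVar_unroll, writesVar_childProg] at h
  tauto

theorem writesArr_expandProg {a : ℕ} (h : (expandProg m q).WritesArr a) : a = 3 := by
  simp only [expandProg, Prog.WritesArr, writesArr_unroll, writesArr_childProg] at h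
  tauto

theorem runs_childProg {i c : ℕ} {s : State} {t : Fin n} (hn : s.var 0 = n)
    (hne : s.var 1 ≠ s.var 2) (ht : s.var (branchReg i) = t) :
    Runs (childProg i c) s (30 * (n + 1)) fun s' => s'.var 2 = s.var 2 + 1 ∧
      row n s' (s.var 2) = Function.update (row n s (s.var 1)) t (c + 2) ∧
      ∀ j, j ≠ s.var 2 → row n s' j = row n s j := by
  have hb5 : branchReg i ≠ 5 := by rw [branchReg]; omega
  refine (Runs.seq ((Runs.forAll (T := 6) (I := fun k s' =>
    (∀ v < k, s'.arr 3 (s.var 2) v = s.arr 3 (s.var 1) v) ∧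
      ∀ j, j ≠ s.var 2 → s'.arr 3 j = s.arr 3 j) (by norm_num) hn (by simp [Prog.WritesVar])
    (by simp [Prog.WritesVar]) (by simp) ?_).frame.mono le_rfl ?_)).mono
    (T := (n + 1) * (6 + 8) + (4 + 4)) (by omega) fun _ h => h
  · rintro k hk s₁ ⟨h₁, h₁'⟩ - hk₁ hv -
    have h1 : s₁.var 1 = s.var 1 := hv 1 (by norm_num) (by simp [Prog.WritesVar])
    have h2 : s₁.var 2 = s.var 2 := hv 2 (by norm_num) (by simp [Prog.WritesVar])
    refine Runs.put ?_
    simp only [Expr.eval, h1, h2, hk₁, State.setVar_arr, State.setArr_arr]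
    refine ⟨fun v hvk => ?_, fun j hj => ?_⟩
    · split_ifs with h
      · rw [h₁' _ hne, h.2.2]
      · exact h₁ v (by simp at h; omega)
    · funext v
      simp only [State.setArr_arr, hj, false_and, and_false, if_false]
      rw [h₁' j hj]
  · rintro s₁ ⟨⟨h₁, h₁'⟩, hv, -⟩
    have h2 : s₁.var 2 = s.var 2 := hv 2 (by simp [Prog.WritesVar])
    have hb : s₁.var (branchReg i) = t := by
      rw [hv _ (by simp [Prog.WritesVar, hb5]), ht]
    refine Runs.seq (Runs.put (Runs.assign ?_))
    refine ⟨by simp [Expr.eval, h2], ?_, fun j hj => ?_⟩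
    · funext v
      by_cases hvt : v = t
      · subst hvt
        simp [row, Expr.eval, h2, hb]
      · have : (v : ℕ) ≠ t := fun h => hvt (Fin.ext h)
        simp [row, Expr.eval, h2, hb, this, hvt, h₁ v v.2]
    · funext v
      simp [row, Expr.eval, h2, hj, h₁' j hj]

/-- The effect of the first `i` branchings at the row at the head of the queue. At this point `e`
of the branching vertices were uncolored and have been given color `0` there, and each of them
has `q - 1` children. -/
structure ExpandInv (G : SimpleGraph (Fin n)) (X : Finset (Fin n)) (Λ : Fin n → Finset (Fin q))
    (θ : ℝ) (t : Fin m → Fin n) (s₀ : State) (i : ℕ) (s : State) : Prop where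
  le : s₀.var 2 ≤ s.var 2
  row_old : ∀ j < s₀.var 2, j ≠ s₀.var 1 → row n s j = row n s₀ j
  head : IsPartialColoring q X (row n s (s₀.var 1))
  row_new : ∀ j, s₀.var 2 ≤ j → j < s.var 2 → IsPartialColoring q X (row n s j) ∧
    uncolored (row n s j) < uncolored (row n s₀ (s₀.var 1))
  keep : ∀ v, row n s₀ (s₀.var 1) v ≠ 0 → row n s (s₀.var 1) v = row n s₀ (s₀.var 1) v
  le_one : ∀ v, row n s₀ (s₀.var 1) v = 0 → row n s (s₀.var 1) v ≤ 1
  colored : ∀ j : Fin m, (j : ℕ) < i → row n s (s₀.var 1) (t j) ≠ 0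
  extendable_iff : Extendable G X Λ (row n s₀ (s₀.var 1)) ↔
    Extendable G X Λ (row n s (s₀.var 1)) ∨
      ∃ j, s₀.var 2 ≤ j ∧ j < s.var 2 ∧ Extendable G X Λ (row n s j)
  weight : ∃ e ≤ i, uncolored (row n s (s₀.var 1)) + e = uncolored (row n s₀ (s₀.var 1)) ∧
    ∑ j ∈ Finset.Ico (s₀.var 2) (s.var 2), θ ^ uncolored (row n s j) =
      ((q : ℝ) - 1) * ∑ a ∈ Finset.range e, θ ^ (uncolored (row n s (s₀.var 1)) + a)

theorem ExpandInv.step {G : SimpleGraph (Fin n)} {X : Finset (Fin n)} {Λ : Fin n → Finset (Fin q)}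
    {θ : ℝ} {t : Fin m → Fin n} {s₀ s s' : State} {i : ℕ} (hq : 2 ≤ q) (hi : i < m)
    (hlt : s₀.var 1 < s₀.var 2) (h : ExpandInv G X Λ θ t s₀ i s)
    (h0 : row n s (s₀.var 1) (t ⟨i, hi⟩) = 0) (hk : s'.var 2 = s.var 2 + (q - 1))
    (hold : ∀ j < s.var 2, j ≠ s₀.var 1 → row n s' j = row n s j)
    (hhead : row n s' (s₀.var 1) = Function.update (row n s (s₀.var 1)) (t ⟨i, hi⟩) 1)
    (hnew : ∀ c < q - 1, row n s' (s.var 2 + c) =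
      Function.update (row n s (s₀.var 1)) (t ⟨i, hi⟩) (c + 2)) :
    ExpandInv G X Λ θ t s₀ (i + 1) s' := by
  have hle := h.le
  have hX : t ⟨i, hi⟩ ∈ X := by
    by_contra hno
    exact h.head.2 _ hno h0
  have hpc : ∀ a, a ≠ 0 → a ≤ q →
      IsPartialColoring q X (Function.update (row n s (s₀.var 1)) (t ⟨i, hi⟩) a) := by
    refine fun a ha haq => ⟨fun v => ?_, fun v hv => ?_⟩ <;> by_cases hvt : v = t ⟨i, hi⟩
    · subst hvt; simpa using haq
    · simpa [hvt] using h.head.1 v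
    · subst hvt; simpa using ha
    · simpa [hvt] using h.head.2 v hv
  have hunc := fun a (ha : a ≠ 0) => uncolored_update h0 ha
  obtain ⟨e, hei, he, hsum⟩ := h.weight
  have h1 := hunc 1 one_ne_zero
  refine ⟨by omega, fun j hj hjh => ?_, ?_, fun j hj hjk => ?_, fun v hv => ?_, fun v hv => ?_,
    fun j hj => ?_, ?_, e + 1, by omega, ?_, ?_⟩
  · rw [hold j (by omega) hjh, h.row_old j hj hjh]
  · rw [hhead]
    exact hpc 1 one_ne_zero (by omega)
  · by_cases hjs : j < s.var 2
    · rw [hold j hjs (by omega)]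
      exact h.row_new j hj hjs
    · obtain ⟨c, rfl⟩ := Nat.exists_eq_add_of_le (not_lt.1 hjs)
      rw [hnew c (by omega)]
      have := hunc (c + 2) (by omega)
      exact ⟨hpc _ (by omega) (by omega), by omega⟩
  · rw [hhead, Function.update_of_ne, h.keep v hv]
    rintro rfl
    rw [h.keep _ hv] at h0
    exact hv h0
  · rw [hhead]
    by_cases hvt : v = t ⟨i, hi⟩
    · subst hvt; simp
    · simpa [hvt] using h.le_one v hv
  · rw [hhead]
    by_cases hvt : t j = t ⟨i, hi⟩
    · rw [hvt]; simp
    · rw [Function.update_of_ne hvt]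
      refine h.colored j (lt_of_le_of_ne (by omega) fun hji => hvt ?_)
      congr 1
      exact Fin.ext hji
  · rw [h.extendable_iff, extendable_iff_update hX h0, hhead, or_assoc]
    refine or_congr_right ⟨?_, ?_⟩
    · rintro (⟨c, hc, hE⟩ | ⟨j, hj, hjs, hE⟩)
      · exact ⟨s.var 2 + c, by omega, by omega, by rwa [hnew c hc]⟩
      · exact ⟨j, hj, by omega, by rwa [hold j hjs (by omega)]⟩
    · rintro ⟨j, hj, hjk, hE⟩
      by_cases hjs : j < s.var 2
      · rw [hold j hjs (by omega)] at hE
        exact Or.inr ⟨j, hj, hjs, hE⟩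
      · obtain ⟨c, rfl⟩ := Nat.exists_eq_add_of_le (not_lt.1 hjs)
        rw [hnew c (by omega)] at hE
        exact Or.inl ⟨c, by omega, hE⟩
  · rw [hhead]
    omega
  · set u := uncolored (Function.update (row n s (s₀.var 1)) (t ⟨i, hi⟩) 1) with hu
    have hsum_old : ∑ j ∈ Finset.Ico (s₀.var 2) (s.var 2), θ ^ uncolored (row n s' j) =
        ((q : ℝ) - 1) * ∑ a ∈ Finset.range e, θ ^ (u + (a + 1)) := by
      rw [← h1] at hsum
      simp only [← add_assoc, add_right_comm u _ 1, ← hsum]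
      refine Finset.sum_congr rfl fun j hj => ?_
      rw [Finset.mem_Ico] at hj
      rw [hold j hj.2 (by omega)]
    have hsum_new : ∑ j ∈ Finset.Ico (s.var 2) (s'.var 2), θ ^ uncolored (row n s' j) =
        ((q : ℝ) - 1) * θ ^ u := by
      rw [hk, Finset.sum_Ico_eq_sum_range, Nat.add_sub_cancel_left]
      have : ∀ c ∈ Finset.range (q - 1), θ ^ uncolored (row n s' (s.var 2 + c)) = θ ^ u := by
        intro c hc
        have := hunc (c + 2) (by omega)
        rw [hnew c (Finset.mem_range.1 hc)]
        congr 1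
        omega
      rw [Finset.sum_congr rfl this, Finset.sum_const, Finset.card_range, nsmul_eq_mul,
        Nat.cast_sub (by omega), Nat.cast_one]
    rw [← Finset.sum_Ico_consecutive _ hle (show s.var 2 ≤ s'.var 2 by omega), hhead, hsum_old,
      hsum_new, ← mul_add, Finset.sum_range_succ']
    rfl

theorem runs_expandProg {G : SimpleGraph (Fin n)} {X : Finset (Fin n)}
    {Λ : Fin n → Finset (Fin q)} {θ : ℝ} {t : Fin m → Fin n} {s₀ : State} (hq : 2 ≤ q)
    (hlt : s₀.var 1 < s₀.var 2) (hn : s₀.var 0 = n)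
    (hσ : IsPartialColoring q X (row n s₀ (s₀.var 1)))
    (ht : ∀ i : Fin m, s₀.var (branchReg i) = t i) :
    Runs (expandProg m q) s₀ ((m * (q * 30 + 20) + 1) * (n + 1)) (ExpandInv G X Λ θ t s₀ m) := by
  have hb5 : ∀ i, branchReg i ≠ 5 := fun i => by rw [branchReg]; omega
  have hb2 : ∀ i, branchReg i ≠ 2 := fun i => by rw [branchReg]; omega
  refine (Runs.unroll (T := (q * 30 + 20) * (n + 1)) (I := ExpandInv G X Λ θ t s₀) ?_ ?_).mono
    ?_ fun _ h => h
  · refine ⟨le_rfl, fun _ _ _ => rfl, hσ, fun j h1 h2 => absurd h1 (by omega), fun _ _ => rfl,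
      fun v hv => by rw [hv]; exact Nat.zero_le _, by simp, ⟨Or.inl, ?_⟩, 0, le_rfl, rfl, by simp⟩
    rintro (h | ⟨j, h1, h2, -⟩)
    · exact h
    · omega
  · rintro i hi s hs hv -
    have hvar : ∀ y, y ≠ 5 → y ≠ 2 → s.var y = s₀.var y := fun y h5 h2 => hv y fun j _ => by
      simp [Prog.WritesVar, writesVar_childProg, h5, h2]
    have h1 := hvar 1 (by norm_num) (by norm_num)
    have hti : s.var (branchReg i) = t ⟨i, hi⟩ := (hvar _ (hb5 i) (hb2 i)).trans (ht ⟨i, hi⟩)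
    have hle := hs.le
    have hget : (Expr.get 3 (.var 1) (.var (branchReg i))).eval s =
        row n s (s₀.var 1) (t ⟨i, hi⟩) := by
      simp [Expr.eval, row, h1, hti]
    refine (Runs.branch (T := (q - 1) * (30 * (n + 1)) + 1 + 4) (fun hc => (Runs.skip ?_).mono
      (by omega) fun _ h => h) (fun hc => Runs.seq ((Runs.unroll (T := 30 * (n + 1))
      (I := fun c s' => s'.var 2 = s.var 2 + c ∧ (∀ j < s.var 2, row n s' j = row n s j) ∧
        ∀ c' < c, row n s' (s.var 2 + c') =
          Function.update (row n s (s₀.var 1)) (t ⟨i, hi⟩) (c' + 2))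
      ⟨rfl, fun _ _ => rfl, by simp⟩ ?_).frame.mono le_rfl ?_))).mono ?_ fun _ h => h
    · rw [hget] at hc
      obtain ⟨e, he, hw⟩ := hs.weight
      refine { hs with
        colored := fun j hj => ?_
        weight := ⟨e, by omega, hw⟩ }
      obtain hji | hji := Nat.lt_succ_iff_lt_or_eq.1 hj
      · exact hs.colored j hji
      · rwa [show j = ⟨i, hi⟩ from Fin.ext hji]
    · rintro c hc s₁ ⟨h₁, h₁', h₁''⟩ hv₁ -
      have hvar₁ : ∀ y, y ≠ 5 → y ≠ 2 → s₁.var y = s.var y := fun y h5 h2 => hv₁ y fun j _ => by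
        simp [writesVar_childProg, h5, h2]
      have h11 : s₁.var 1 = s₀.var 1 := (hvar₁ 1 (by norm_num) (by norm_num)).trans h1
      refine (runs_childProg (t := t ⟨i, hi⟩)
        (by rw [hvar₁ 0 (by norm_num) (by norm_num), hvar 0 (by norm_num) (by norm_num), hn])
        (by omega) (by rw [hvar₁ _ (hb5 i) (hb2 i), hti])).mono le_rfl ?_
      rintro s₂ ⟨h₂, h₂', h₂''⟩
      refine ⟨by omega, fun j hj => ?_, fun c' hc' => ?_⟩
      · rw [h₂'' j (by omega), h₁' j hj]
      · obtain hcc | rfl := Nat.lt_succ_iff_lt_or_eq.1 hc'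
        · rw [h₂'' _ (by omega), h₁'' c' hcc]
        · rw [← h₁, h₂', h11, h₁' _ (by omega)]
    · rintro s₁ ⟨⟨h₁, h₁', h₁''⟩, hv₁, -⟩
      have hvar₁ : ∀ y, y ≠ 5 → y ≠ 2 → s₁.var y = s.var y := fun y h5 h2 => hv₁ y <| by
        simp [writesVar_childProg, h5, h2]
      have h11 : s₁.var 1 = s₀.var 1 := (hvar₁ 1 (by norm_num) (by norm_num)).trans h1
      have hti₁ : s₁.var (branchReg i) = t ⟨i, hi⟩ := (hvar₁ _ (hb5 i) (hb2 i)).trans hti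
      refine Runs.put (hs.step hq hi hlt (hget.symm.trans hc) h₁ (fun j hj hjh => ?_) ?_
        fun c hc => ?_)
      · rw [← h₁' j hj]
        funext v
        simp [row, Expr.eval, h11, hjh]
      · rw [← h₁' _ (by omega)]
        funext v
        by_cases hvt : v = t ⟨i, hi⟩
        · subst hvt
          simp [row, Expr.eval, h11, hti₁]
        · have : (v : ℕ) ≠ t ⟨i, hi⟩ := fun h => hvt (Fin.ext h)
          simp [row, Expr.eval, h11, hti₁, this, hvt]
      · rw [← h₁'' c hc]
        funext v
        simp [row, Expr.eval, h11, show s.var 2 + c ≠ s₀.var 1 by omega]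
    · simp only [Expr.cost]
      have : (q - 1) * (30 * (n + 1)) ≤ q * (30 * (n + 1)) := Nat.mul_le_mul_right _ (by omega)
      nlinarith
  · nlinarith [Nat.zero_le (m * (q * 30 + 20) * n)]

end RAM

namespace RAM

variable {n q m : ℕ}

/-! ### Correctness and running time of the branching program -/

/-- The loop invariant of the branching program: the instance has answer Yes if and only if this
has been found out already or some partial coloring in the queue is extendable. -/
structure QueueInv (G : SimpleGraph (Fin n)) (X : Finset (Fin n)) (Λ : Fin n → Finset (Fin q))
    (s : State) : Prop extends Holds G X Λ s where
  le : s.var 1 ≤ s.var 2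
  isPartialColoring : ∀ j, s.var 1 ≤ j → j < s.var 2 → IsPartialColoring q X (row n s j)
  listColorable_iff : ListColorable G Λ ↔
    s.var 3 ≠ 0 ∨ ∃ j, s.var 1 ≤ j ∧ j < s.var 2 ∧ Extendable G X Λ (row n s j)

/-- The potential of the queue. A partial coloring with `u` uncolored vertices has weight
`(u + 1) * θ ^ u`: the power of `θ` bounds the number of leaves below it, and the factor `u + 1`
accounts for the inner nodes. -/
noncomputable def potential (n : ℕ) (θ : ℝ) (s : State) : ℝ :=
  ∑ j ∈ Finset.Ico (s.var 1) (s.var 2),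
    ((uncolored (row n s j) : ℝ) + 1) * θ ^ uncolored (row n s j)

theorem Extendable.listColorable {G : SimpleGraph (Fin n)} {X : Finset (Fin n)}
    {Λ : Fin n → Finset (Fin q)} {σ : Fin n → ℕ} (h : Extendable G X Λ σ) : ListColorable G Λ :=
  let ⟨γ, hγ, _⟩ := h
  ⟨γ, hγ⟩

theorem runs_roundProg (hq : 2 ≤ q) (hm : 2 ≤ m) : ∃ K : ℕ, ∀ (F : GraphClass) (g : ℕ → ℕ) (r : ℕ)
    (θ : ℝ), HasNoCertificates F g q → g q ≤ m → m ≤ r → 1 ≤ θ → θ ≤ q →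
      θ ^ r = (q : ℝ) ^ r - 1 →
      ∀ (n : ℕ) (G : SimpleGraph (Fin n)) (X : Finset (Fin n)) (Λ : Fin n → Finset (Fin q)),
        IsModulator F G X → ∀ s : State, QueueInv G X Λ s → s.var 1 < s.var 2 →
          Runs (roundProg m q) s (K * (n + 1) ^ m) fun s' =>
            QueueInv G X Λ s' ∧ potential n θ s' + 1 ≤ potential n θ s := by
  obtain ⟨K₁, hK₁⟩ := runs_blockProg q
  obtain ⟨K₂, hK₂⟩ := runs_searchProg m (q := q) (by omega)
  refine ⟨K₁ + K₂ + (m * (q * 30 + 20) + 1) + 10,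
    fun F g r θ hF hgm hmr hθ1 hθq hθ n G X Λ hX s hs hlt => ?_⟩
  set σ := row n s (s.var 1) with hσ
  have hσX : IsPartialColoring q X σ := hs.isPartialColoring _ le_rfl hlt
  have hθ0 : (0 : ℝ) < θ := by linarith
  -- The weight of the rows behind the head does not change.
  have hsplit : potential n θ s = ((uncolored σ : ℝ) + 1) * θ ^ uncolored σ +
      ∑ j ∈ Finset.Ico (s.var 1 + 1) (s.var 2),
        ((uncolored (row n s j) : ℝ) + 1) * θ ^ uncolored (row n s j) := by
    rw [potential, Finset.sum_eq_sum_Ico_succ_bot hlt]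
  have hex : ListColorable G Λ ↔ s.var 3 ≠ 0 ∨ Extendable G X Λ σ ∨
      ∃ j, s.var 1 < j ∧ j < s.var 2 ∧ Extendable G X Λ (row n s j) := by
    rw [hs.listColorable_iff]
    refine or_congr_right ⟨?_, ?_⟩
    · rintro ⟨j, h1, h2, h3⟩
      obtain rfl | h1 := h1.eq_or_lt
      · exact Or.inl h3
      · exact Or.inr ⟨j, h1, h2, h3⟩
    · rintro (h | ⟨j, h1, h2, h3⟩)
      · exact ⟨_, le_rfl, hlt, h⟩
      · exact ⟨j, h1.le, h2, h3⟩
  have hpow : 1 ≤ (n + 1) ^ m := Nat.one_le_pow _ _ (by omega)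
  have hpow1 : n + 1 ≤ (n + 1) ^ m := Nat.le_self_pow (by omega) _
  have hpow2 : (n + 1) ^ 2 ≤ (n + 1) ^ m := Nat.pow_le_pow_right (by omega) hm
  refine (Runs.seq ((hK₁ n G X Λ s hs.toHolds).frame.mono le_rfl ?_)).mono (T := K₁ * (n + 1) ^ 2 +
    (K₂ * (n + 1) ^ m + ((1 + 1 + (m * (q * 30 + 20) + 1) * (n + 1)) + 4))) ?_ fun _ h => h
  swap
  · nlinarith [Nat.mul_le_mul_left K₁ hpow2, Nat.mul_le_mul_left (m * (q * 30 + 20) + 1) hpow1]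
  rintro s₁ ⟨h₁, hv₁, ha₁⟩
  have hv₁' : ∀ y, y < 4 → s₁.var y = s.var y := fun y hy => hv₁ y <| by
    simp [blockProg, Prog.WritesVar]
    omega
  have ha₁' : ∀ a, a ≠ 4 → s₁.arr a = s.arr a := fun a ha => ha₁ a <| by
    simp [blockProg, Prog.WritesArr, ha]
  have hrow₁ : ∀ j, row n s₁ j = row n s j := fun j => by
    funext v
    simp only [row, ha₁' 3 (by norm_num)]
  have hs₁ : Holds G X Λ s₁ := hs.toHolds.congr (hv₁' 0 (by norm_num)) (ha₁' 0 (by norm_num))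
    (ha₁' 1 (by norm_num)) (ha₁' 2 (by norm_num))
  have hσ₁ : row n s₁ (s₁.var 1) = σ := by rw [hrow₁, hv₁' 1 (by norm_num)]
  have hK := hK₂ n G X Λ s₁ hs₁ (by rw [hσ₁]; exact h₁)
  rw [hσ₁] at hK
  refine Runs.seq (hK.frame.mono le_rfl ?_)
  rintro s₂ ⟨⟨h₂, h₂'⟩, hv₂, ha₂⟩
  have hv₂' : ∀ y, y < 4 → s₂.var y = s.var y := fun y hy => by
    rw [hv₂ y, hv₁' y hy]
    simp only [searchProg, Prog.WritesVar, writesVar_forAllTuples, tupleReg]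
    rintro (h | ⟨i, -, h⟩ | h)
    · omega
    · omega
    · exact not_writesVar_checkProg (by omega) (by omega) h
  have ha₂' : s₂.arr = s₁.arr := funext fun a => ha₂ a <| by
    simp only [searchProg, Prog.WritesArr, writesArr_forAllTuples, false_or]
    exact not_writesArr_checkProg
  have hrow₂ : ∀ j, row n s₂ j = row n s j := fun j => by
    rw [← hrow₁]
    funext v
    simp only [row, ha₂']
  have hs₂ : Holds G X Λ s₂ := hs₁.congr
    ((hv₂' 0 (by norm_num)).trans (hv₁' 0 (by norm_num)).symm) (by rw [ha₂']) (by rw [ha₂'])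
    (by rw [ha₂'])
  have hv21 := hv₂' 1 (by norm_num)
  have hv22 := hv₂' 2 (by norm_num)
  have hσ₂ : row n s₂ (s₂.var 1) = σ := by rw [hrow₂, hv21]
  refine Runs.seq (Runs.branch (fun hc => ?_) fun hc => ?_)
  · obtain ⟨x, t, hx, ht, htX, htB⟩ := h₂ hc
    refine (runs_expandProg (G := G) (Λ := Λ) (θ := θ) hq (by omega) hs₂.1 (by rwa [hσ₂])
      ht).frame.mono le_rfl ?_
    rintro s₃ ⟨h₃, hv₃, ha₃⟩
    have hv₃' : ∀ y, y ≠ 2 → y ≠ 5 → s₃.var y = s₂.var y := fun y h2 h5 => hv₃ y fun h => by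
      have := writesVar_expandProg h
      omega
    have ha₃' : ∀ a, a ≠ 3 → s₃.arr a = s₂.arr a := fun a h3 => ha₃ a fun h =>
      h3 (writesArr_expandProg h)
    have hv31 : s₃.var 1 = s.var 1 := (hv₃' 1 (by norm_num) (by norm_num)).trans hv21
    have hv33 : s₃.var 3 = s.var 3 :=
      (hv₃' 3 (by norm_num) (by norm_num)).trans (hv₂' 3 (by norm_num))
    have hs₃ : Holds G X Λ s₃ := hs₂.congr (hv₃' 0 (by norm_num) (by norm_num))
      (ha₃' 0 (by norm_num)) (ha₃' 1 (by norm_num)) (ha₃' 2 (by norm_num))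
    have hno : ¬ Extendable G X Λ (row n s₃ (s₂.var 1)) := by
      refine not_extendable_of_not_tupleColorable hx htX htB ?_ ?_ fun i => h₃.colored i i.2
      · rw [← hσ₂]
        exact h₃.keep
      · rw [← hσ₂]
        exact h₃.le_one
    have hiff := h₃.extendable_iff
    have hle := h₃.le
    rw [hσ₂, or_iff_right hno, hv22] at hiff
    have hold : ∀ j, s.var 1 < j → j < s.var 2 → row n s₃ j = row n s j := fun j h1 h2 => by
      rw [h₃.row_old j (by omega) (by omega), hrow₂]
    refine Runs.assign ⟨⟨hs₃.congr (by simp [Expr.eval]) rfl rfl rfl, ?_, ?_, ?_⟩, ?_⟩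
    · simp only [Expr.eval, State.setVar_var, if_true, OfNat.ofNat_ne_one, if_false]
      omega
    · intro j h1 h2
      simp only [Expr.eval, State.setVar_var, if_true, OfNat.ofNat_ne_one, if_false] at h1 h2
      change IsPartialColoring q X (row n s₃ j)
      by_cases hj : j < s.var 2
      · rw [hold j (by omega) hj]
        exact hs.isPartialColoring j (by omega) hj
      · exact (h₃.row_new j (by omega) h2).1
    · simp only [Expr.eval, State.setVar_var, if_true, OfNat.ofNat_ne_one, if_false, hv31, hv33]
      rw [hex, hiff]
      refine or_congr_right ⟨?_, ?_⟩
      · rintro (⟨j, h1, h2, h3⟩ | ⟨j, h1, h2, h3⟩)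
        · exact ⟨j, by omega, h2, h3⟩
        · exact ⟨j, h1, by omega, show Extendable G X Λ (row n s₃ j) by rwa [hold j h1 h2]⟩
      · rintro ⟨j, h1, h2, h3⟩
        change Extendable G X Λ (row n s₃ j) at h3
        by_cases hj : j < s.var 2
        · exact Or.inr ⟨j, by omega, hj, by rwa [← hold j (by omega) hj]⟩
        · exact Or.inl ⟨j, by omega, h2, h3⟩
    · -- The children together weigh less than the head did.
      obtain ⟨e, hem, he, hw⟩ := h₃.weight
      rw [hσ₂] at he
      rw [hv22] at hw hle
      have hgeom := geom_sum_le_of_pow_eq (by omega) hθ0 hθq hθ (hem.trans hmr)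
      have hsum : ∑ j ∈ Finset.Ico (s.var 2) (s₃.var 2), θ ^ uncolored (row n s₃ j) ≤
          θ ^ uncolored σ := by
        rw [hw, ← he, pow_add]
        simp only [pow_add, ← Finset.mul_sum]
        calc _ = θ ^ uncolored (row n s₃ (s₂.var 1)) *
              (((q : ℝ) - 1) * ∑ a ∈ Finset.range e, θ ^ a) := by ring
          _ ≤ _ := by gcongr
      have hsum' : ∑ j ∈ Finset.Ico (s.var 2) (s₃.var 2),
          ((uncolored (row n s₃ j) : ℝ) + 1) * θ ^ uncolored (row n s₃ j) ≤
          uncolored σ * θ ^ uncolored σ := by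
        refine le_trans (Finset.sum_le_sum (g := fun j =>
          (uncolored σ : ℝ) * θ ^ uncolored (row n s₃ j)) fun j hj => ?_) ?_
        · rw [Finset.mem_Ico] at hj
          have := (h₃.row_new j (by omega) hj.2).2
          rw [hσ₂] at this
          gcongr
          exact_mod_cast this
        · rw [← Finset.mul_sum]
          gcongr
      have hpot : potential n θ (s₃.setVar 1 ((Expr.add (.var 1) (.const 1)).eval s₃)) =
          ∑ j ∈ Finset.Ico (s.var 1 + 1) (s.var 2),
            ((uncolored (row n s j) : ℝ) + 1) * θ ^ uncolored (row n s j) +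
          ∑ j ∈ Finset.Ico (s.var 2) (s₃.var 2),
            ((uncolored (row n s₃ j) : ℝ) + 1) * θ ^ uncolored (row n s₃ j) := by
        simp only [potential, Expr.eval, State.setVar_var, if_true, OfNat.ofNat_ne_one, if_false,
          hv31]
        rw [← Finset.sum_Ico_consecutive _ (show s.var 1 + 1 ≤ s.var 2 by omega) hle]
        congr 1
        refine Finset.sum_congr rfl fun j hj => ?_
        rw [Finset.mem_Ico] at hj
        rw [← hold j (by omega) hj.2]
        rfl
      have : 1 ≤ θ ^ uncolored σ := one_le_pow₀ hθ1
      rw [hpot, hsplit]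
      linarith
  · have hcol : ListColorable G Λ :=
      listColorable_of_tupleColorable hq hF hX hgm hm hσX (h₂' hc)
    have hbound : 2 ≤ (m * (q * 30 + 20) + 1) * (n + 1) := by
      have := Nat.mul_le_mul hm (Nat.le_add_left 20 (q * 30))
      nlinarith
    refine (Runs.assign (Runs.assign ?_)).mono (T := 2) hbound fun _ h => h
    refine ⟨⟨hs₂.congr (by simp [Expr.eval]) rfl rfl rfl, ?_, ?_, ?_⟩, ?_⟩
    · simp only [Expr.eval, State.setVar_var]
      simp
      omega
    · intro j h1 h2
      simp [Expr.eval] at h1 h2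
      change IsPartialColoring q X (row n s₂ j)
      rw [hrow₂]
      exact hs.isPartialColoring j (by omega) (by omega)
    · simp [Expr.eval, hcol]
    · have hpot : potential n θ ((s₂.setVar 3 ((Expr.const 1).eval s₂)).setVar 1
          ((Expr.add (.var 1) (.const 1)).eval (s₂.setVar 3 ((Expr.const 1).eval s₂)))) =
          ∑ j ∈ Finset.Ico (s.var 1 + 1) (s.var 2),
            ((uncolored (row n s j) : ℝ) + 1) * θ ^ uncolored (row n s j) := by
        have : (Expr.add (.var 1) (.const 1)).eval (s₂.setVar 3 ((Expr.const 1).eval s₂)) =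
            s.var 1 + 1 := by
          simp [Expr.eval, hv21]
        rw [this]
        simp only [potential, State.setVar_var, if_true, OfNat.ofNat_ne_one, if_false,
          show (2 : ℕ) ≠ 3 by norm_num, hv22]
        refine Finset.sum_congr rfl fun j hj => ?_
        rw [← hrow₂]
        rfl
      have h1 : 1 ≤ θ ^ uncolored σ := one_le_pow₀ hθ1
      have h2 : (0 : ℝ) ≤ uncolored σ := Nat.cast_nonneg _
      rw [hpot, hsplit]
      nlinarith

theorem runs_listColoringProg (hq : 2 ≤ q) (hm : 2 ≤ m) : ∃ K : ℕ, ∀ (F : GraphClass) (g : ℕ → ℕ)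
    (r : ℕ) (θ : ℝ), HasNoCertificates F g q → g q ≤ m → m ≤ r → 1 ≤ θ → θ ≤ q →
      θ ^ r = (q : ℝ) ^ r - 1 →
      ∀ (n : ℕ) (G : SimpleGraph (Fin n)) (X : Finset (Fin n)) (Λ : Fin n → Finset (Fin q)),
        IsModulator F G X → ∀ s : State, Holds G X Λ s →
          ∃ T : ℕ, (T : ℝ) ≤ K * θ ^ X.card * ((n : ℝ) + 1) ^ (m + 1) ∧
            Runs (listColoringProg m q) s T fun s' => s'.var 0 ≠ 0 ↔ ListColorable G Λ := by
  obtain ⟨K, hK⟩ := runs_roundProg hq hm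
  refine ⟨2 * (K + 4) + 50, fun F g r θ hF hgm hmr hθ1 hθq hθ n G X Λ hX s hs => ?_⟩
  have hθ0 : (0 : ℝ) < θ := by linarith
  set N : ℕ := ⌈((X.card : ℝ) + 1) * θ ^ X.card⌉₊ with hN
  refine ⟨(n + 1) * (10 + 8) + (2 + (2 + (2 + (N * (3 + 1 + K * (n + 1) ^ m) + (3 + 1) + 2)))),
    ?_, ?_⟩
  · have hXn : (X.card : ℝ) ≤ n := by exact_mod_cast (Finset.card_le_univ X).trans_eq (by simp)
    have hP : (1 : ℝ) ≤ θ ^ X.card := one_le_pow₀ hθ1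
    have hn0 : (0 : ℝ) ≤ n := Nat.cast_nonneg n
    have hn1 : (1 : ℝ) ≤ ((n : ℝ) + 1) ^ m := one_le_pow₀ (by linarith)
    have hK0 : (0 : ℝ) ≤ K := Nat.cast_nonneg K
    set P := θ ^ X.card with hPdef
    set A := ((n : ℝ) + 1) ^ m with hA
    have hPn : 1 ≤ P * (n + 1) := by nlinarith
    have hNle : (N : ℝ) ≤ 2 * (P * (n + 1)) := by
      have := (Nat.ceil_lt_add_one (show 0 ≤ ((X.card : ℝ) + 1) * P by positivity)).le
      have h2 : ((X.card : ℝ) + 1) * P ≤ P * (n + 1) := by nlinarith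
      rw [hN]
      linarith
    have hA' : (3 + 1 + K * A : ℝ) ≤ (K + 4) * A := by nlinarith
    have hPA : P * (n + 1) ≤ P * (n + 1) * A := by nlinarith
    have hn : (n : ℝ) + 1 ≤ P * (n + 1) := by nlinarith
    have hmain : (N : ℝ) * (3 + 1 + K * A) ≤ 2 * (P * (n + 1)) * ((K + 4) * A) := by gcongr
    push_cast
    rw [pow_succ, ← hA]
    nlinarith
  · refine Runs.seq ((Runs.forAll (T := 10) (I := fun k s' => ∀ v < k,
      s'.arr 3 0 v = 1 - s.arr 1 v 0) (by norm_num) hs.1 (by simp [Prog.WritesVar])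
      (by simp [Prog.WritesVar]) (by simp) ?_).frame.mono le_rfl ?_)
    · rintro k hk s₁ h₁ - hk₁ hv ha
      have ha1 : s₁.arr 1 = s.arr 1 := ha 1 (by simp [Prog.WritesArr])
      refine (Runs.put ?_).mono (by simp [Expr.cost, Expr.neg]) fun _ h => h
      intro v hvk
      simp only [State.setVar_arr, State.setArr_arr, Expr.eval, Expr.neg, hk₁, ha1, true_and]
      split_ifs with h
      · rw [h]
      · exact h₁ v (by omega)
    · rintro s₁ ⟨h₁, hv₁, ha₁⟩
      have hs₁ : Holds G X Λ s₁ := hs.congr (hv₁ 0 (by simp [Prog.WritesVar]))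
        (ha₁ 0 (by simp [Prog.WritesArr])) (ha₁ 1 (by simp [Prog.WritesArr]))
        (ha₁ 2 (by simp [Prog.WritesArr]))
      have hrow : ∀ v, row n s₁ 0 v = 0 ↔ v ∈ X := by
        intro v
        rw [row, h₁ v v.2, ← hs.mem]
        omega
      refine Runs.seq (Runs.assign (Runs.seq (Runs.assign (Runs.seq (Runs.assign ?_)))))
      set s₂ := ((s₁.setVar 1 ((Expr.const 0).eval s₁)).setVar 2 _).setVar 3 _ with hs₂def
      have hs₂ : Holds G X Λ s₂ := hs₁.congr (by simp [hs₂def]) rfl rfl rfl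
      have h21 : s₂.var 1 = 0 := by simp [hs₂def, Expr.eval]
      have h22 : s₂.var 2 = 1 := by simp [hs₂def, Expr.eval]
      have h23 : s₂.var 3 = 0 := by simp [hs₂def, Expr.eval]
      have hrow₂ : ∀ v, row n s₂ 0 v = 0 ↔ v ∈ X := hrow
      refine Runs.seq ((Runs.loop (I := QueueInv G X Λ) (Φ := potential n θ)
        (T := K * (n + 1) ^ m) ?_ ?_ N s₂ ?_ ?_).mono le_rfl ?_)
      · intro s' _
        exact Finset.sum_nonneg fun j _ => by positivity
      · intro s' hs' he
        simp only [Expr.eval] at he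
        exact hK F g r θ hF hgm hmr hθ1 hθq hθ n G X Λ hX s' hs' (by omega)
      · refine ⟨hs₂, by omega, fun j _ hj => ?_, ?_⟩
        · obtain rfl : j = 0 := by omega
          refine ⟨fun v => ?_, fun v hv h => hv ((hrow₂ v).1 h)⟩
          have : row n s₂ 0 v = 1 - s.arr 1 v 0 := h₁ v v.2
          omega
        · rw [h21, h22, h23]
          refine ⟨fun ⟨γ, hγ⟩ => Or.inr ⟨0, le_rfl, one_pos, γ, hγ, fun v hv h =>
            absurd ((hrow₂ v).2 hv) h⟩, ?_⟩
          rintro (h | ⟨j, -, -, h⟩)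
          · exact absurd rfl h
          · exact Extendable.listColorable h
      · have : uncolored (row n s₂ 0) = X.card := by
          simp [uncolored, hrow₂]
        simp only [potential, h21, h22, Nat.Ico_succ_singleton, Finset.sum_singleton, this]
        exact Nat.le_ceil _
      · rintro s₃ ⟨h₃, he⟩
        simp only [Expr.eval] at he
        refine Runs.assign ?_
        simp only [Expr.eval, State.setVar_var, if_true]
        rw [h₃.listColorable_iff]
        refine ⟨Or.inl, ?_⟩
        rintro (h | ⟨j, h1, h2, -⟩)
        · exact h
        · omega

theorem table_ne_zero {k l : ℕ} {R : Fin k → Fin l → Prop} {i : Fin k} {j : Fin l} :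
    table R i j ≠ 0 ↔ R i j := by
  simp [table]

theorem holds_listColoringInput (G : SimpleGraph (Fin n)) (X : Finset (Fin n))
    (Λ : Fin n → Finset (Fin q)) : Holds G X Λ (listColoringInput G X Λ) :=
  ⟨rfl, fun _ _ => table_ne_zero,
    fun v => table_ne_zero (R := fun v (_ : Fin 1) => v ∈ X) (i := v) (j := 0),
    fun _ _ => table_ne_zero (R := fun v c => c ∈ Λ v)⟩

theorem solvesListColoring {F : GraphClass} {g : ℕ → ℕ} {r : ℕ} {θ : ℝ} (hq : 2 ≤ q) (hm : 2 ≤ m)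
    (hF : HasNoCertificates F g q) (hgm : g q ≤ m) (hmr : m ≤ r) (hθ1 : 1 ≤ θ) (hθq : θ ≤ q)
    (hθ : θ ^ r = (q : ℝ) ^ r - 1) :
    SolvesListColoring (listColoringProg m q) F q θ (m + 1) := by
  obtain ⟨K, hK⟩ := runs_listColoringProg hq hm
  refine ⟨K, fun n G X Λ hX => ?_⟩
  obtain ⟨T, hT, t, s', h1, h2, h3⟩ := hK F g r θ hF hgm hmr hθ1 hθq hθ n G X Λ hX _
    (holds_listColoringInput G X Λ)
  exact ⟨t, s', h1, le_trans (by exact_mod_cast h2) hT, h3⟩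

theorem colorable_iff_listColorable {G : SimpleGraph (Fin n)} :
    G.Colorable q ↔ ListColorable G fun _ => (Finset.univ : Finset (Fin q)) :=
  ⟨fun ⟨γ⟩ => ⟨γ, fun _ => Finset.mem_univ _⟩, fun ⟨γ, _⟩ => ⟨γ⟩⟩

theorem solvesColoring {F : GraphClass} {g : ℕ → ℕ} {r : ℕ} {θ : ℝ} (hq : 2 ≤ q) (hm : 2 ≤ m)
    (hF : HasNoCertificates F g q) (hgm : g q ≤ m) (hmr : m ≤ r) (hθ1 : 1 ≤ θ) (hθq : θ ≤ q)
    (hθ : θ ^ r = (q : ℝ) ^ r - 1) :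
    SolvesColoring (coloringProg m q) F q θ (m + 1) := by
  obtain ⟨K, hK⟩ := runs_listColoringProg hq hm
  refine ⟨(q * 4 + 9 : ℕ) + K, fun n G X hX => ?_⟩
  have hfill : Runs (forAll 5 (unroll q fun c => .put 2 (.var 5) (.const c) (.const 1)))
      (coloringInput G X) ((n + 1) * (q * 4 + 1 + 8))
      fun s => ∀ v < n, ∀ c < q, s.arr 2 v c = 1 := by
    refine Runs.forAll (I := fun k s => ∀ v < k, ∀ c < q, s.arr 2 v c = 1) (by norm_num) rfl
      (by simp [Prog.WritesVar]) (by simp [Prog.WritesVar]) (by simp) ?_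
    rintro k hk s₁ h₁ - hk₁ - -
    refine (Runs.unroll (T := 4) (I := fun c s => (∀ v < k, ∀ c' < q, s.arr 2 v c' = 1) ∧
      ∀ c' < c, s.arr 2 k c' = 1) ⟨h₁, by simp⟩ ?_).mono le_rfl ?_
    · rintro c hc s₂ ⟨h₂, h₂'⟩ hv₂ -
      have : s₂.var 5 = k := (hv₂ 5 (by simp [Prog.WritesVar])).trans hk₁
      refine Runs.put ⟨fun v hv c' hc' => ?_, fun c' hc' => ?_⟩
      · simp only [State.setArr_arr, Expr.eval]
        split_ifs
        · rfl
        · exact h₂ v hv c' hc'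
      · simp only [State.setArr_arr, Expr.eval, this, true_and]
        split_ifs
        · rfl
        · exact h₂' c' (by omega)
    · rintro s₂ ⟨h₂, h₂'⟩ v hv c hc
      obtain hv | rfl := Nat.lt_succ_iff_lt_or_eq.1 hv
      · exact h₂ v hv c hc
      · exact h₂' c hc
  obtain ⟨t₁, s₁, e₁, l₁, h₁, hv, ha⟩ := hfill.frame
  have hs₁ : Holds G X (fun _ => (Finset.univ : Finset (Fin q))) s₁ := by
    refine ⟨(hv 0 (by simp [Prog.WritesVar])).trans rfl, ?_, ?_, fun v c => ?_⟩
    · rw [ha 0 (by simp [Prog.WritesArr])]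
      exact fun _ _ => table_ne_zero
    · rw [ha 1 (by simp [Prog.WritesArr])]
      exact fun v => table_ne_zero (R := fun v (_ : Fin 1) => v ∈ X) (i := v) (j := 0)
    · simp [h₁ v v.2 c c.2]
  obtain ⟨T, hT, t₂, s₂, e₂, l₂, h₂⟩ := hK F g r θ hF hgm hmr hθ1 hθq hθ n G X _ hX s₁ hs₁
  refine ⟨t₁ + t₂, s₂, .seq e₁ e₂, ?_, by rw [colorable_iff_listColorable, h₂]⟩
  have l₁' : (t₁ : ℝ) ≤ ((n + 1) * (q * 4 + 1 + 8) : ℕ) := by exact_mod_cast l₁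
  have l₂' : (t₂ : ℝ) ≤ T := by exact_mod_cast l₂
  have hP : (1 : ℝ) ≤ θ ^ X.card := one_le_pow₀ hθ1
  have hA : ((n : ℝ) + 1) ≤ ((n : ℝ) + 1) ^ (m + 1) :=
    le_self_pow₀ (by linarith [(Nat.cast_nonneg n : (0 : ℝ) ≤ n)]) (by omega)
  have hPA : ((n : ℝ) + 1) ≤ θ ^ X.card * ((n : ℝ) + 1) ^ (m + 1) := by
    nlinarith [(Nat.cast_nonneg n : (0 : ℝ) ≤ n)]
  have h9 : (0 : ℝ) ≤ (q * 4 + 9 : ℕ) := Nat.cast_nonneg _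
  have := mul_le_mul_of_nonneg_left hPA h9
  push_cast at this l₁' ⊢
  nlinarith

end RAM

theorem mainTheorem2 :
    ∃ d : ℕ → ℕ, ∀ (F : GraphClass) (g : ℕ → ℕ) (q : ℕ), 2 ≤ q → HasNoCertificates F g q →
      ∃ p₁ p₂ : RAM.Prog,
        (∃ ε : ℝ, 0 < ε ∧ ε < q ∧
          RAM.SolvesListColoring p₁ F q ((q : ℝ) - ε) (d (g q)) ∧
          RAM.SolvesColoring p₂ F q ((q : ℝ) - ε) (d (g q))) ∧
        (1 ≤ g q →
          RAM.SolvesListColoring p₁ F q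
            (((q : ℝ) ^ (g q * q) - 1) ^ (1 / ((g q * q : ℕ) : ℝ))) (d (g q)) ∧
          RAM.SolvesColoring p₂ F q
            (((q : ℝ) ^ (g q * q) - 1) ^ (1 / ((g q * q : ℕ) : ℝ))) (d (g q))) := by
  refine ⟨fun k => max k 2 + 1, fun F g q hq hF => ?_⟩
  refine ⟨RAM.listColoringProg (max (g q) 2) q, RAM.coloringProg (max (g q) 2) q, ?_, fun hg => ?_⟩
  · obtain ⟨h1, h2, h3⟩ := rpow_root_spec (r := max (g q) 2) hq (by omega)
    set θ : ℝ := ((q : ℝ) ^ max (g q) 2 - 1) ^ (1 / ((max (g q) 2 : ℕ) : ℝ))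
    refine ⟨q - θ, by linarith, by linarith, ?_⟩
    rw [sub_sub_cancel]
    exact ⟨RAM.solvesListColoring hq (by omega) hF (by omega) le_rfl h1 h2.le h3,
      RAM.solvesColoring hq (by omega) hF (by omega) le_rfl h1 h2.le h3⟩
  · have hr : max (g q) 2 ≤ g q * q := max_le (by nlinarith) (by nlinarith)
    obtain ⟨h1, h2, h3⟩ := rpow_root_spec (r := g q * q) hq (by omega)
    exact ⟨RAM.solvesListColoring hq (by omega) hF (by omega) hr h1 h2.le h3,
      RAM.solvesColoring hq (by omega) hF (by omega) hr h1 h2.le h3⟩
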